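/- Let $\Bbbk$ be a field, let $m \ge N \ge 2$ be integers and let $Z$ be a finite-dimensional $\Bbbk$-vector space. Let ${\sf s}\in Z^{\otimes m}$ be a twisted superpotential, i.e. $(\phi\otimes \mathrm{id}^{\otimes (m-1)})\,c({\sf s})={\sf s}$ for some $\phi\in GL(Z)$, where $c(z_1\otimes\cdots\otimes z_m)=z_m\otimes z_1\otimes\cdots\otimes z_{m-1}$. Let $A=A({\sf s},N)=TZ/(R)$, where $R=\partial^{m-N}(\Bbbk{\sf s})\subseteq Z^{\otimes N}$ and $\partial W$ denotes the span of all $(\nu\otimes\mathrm{id})(w)$ with $\nu\in Z^*$, $w\in W$. Assume that * $A$ is $N$-Koszul: the Koszul complex with terms $A\otimes W_{\delta(i)}$, where $W_j=\bigcap_{a+N+b=j}Z^{\otimes a}\otimes R\otimes Z^{\otimes b}$, $\delta(2i)=Ni$, $\delta(2i+1)=Ni+1$, is a resolution of the trivial left module $\Bbbk$; * $A$ is Artin–Schelter regular of global dimension $d$: connected graded, of left and right global dimension and injective dimension $d$, with $\mathrm{Ext}^i_A({}_A\Bbbk,{}_AA)\cong \mathrm{Ext}^i_A(\Bbbk_A,A_A)\cong\delta_{i,d}\Bbbk$;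 * $m=\delta(d)$, i.e. ${\sf s}$ has the degree of the last term of the Koszul resolution (for $N=2$: $m=d$). Let $H$ be a Hopf algebra over $\Bbbk$ with bijective antipode $S$ and let $\rho$ be a right (resp., left) $H$-comodule algebra structure on $A$ which preserves the grading. Choose a resolution $P_\bullet$ of ${}_A\Bbbk$ by $A$-projective Hopf modules (left $A$-modules with a compatible right (resp., left) $H$-coaction, and $H$-colinear maps). The coaction on the one-dimensional space $\mathrm{Ext}^d_A(\Bbbk,\Bbbk)=H^d(\mathrm{Hom}_A(P_\bullet,\Bbbk))$ is the one induced by the antipode: the image of the class of a cocycle $f$ is represented by the $H$-valued cochain $p\mapsto f(p_0)\,S(p_1)$ (resp., $p\mapsto f(p_0)\,S(p_{-1})$). The homological codeterminant of $\rho$ is the element ${\sf D}\in H$ with $\rho(\mathfrak e)={\sf D}\otimes\mathfrak e$ (resp., ${\sf D}$ is invertible and $\rho(\mathfrak e)=\mathfrak e\otimes{\sf D}^{-1}$) for a nonzero $\mathfrak e\in\mathrm{Ext}^d_A(\Bbbk,\Bbbk)$, i.e. if $\mathfrak e$ is the class of $f$, then the cochain above is cohomologous to $p\mapsto f(p){\sf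 D}$ (resp., to $p\mapsto f(p){\sf D}^{-1}$). Let $Z^{\otimes m}$ carry the right (resp., left) $H$-coaction, again denoted $\rho$, that is induced multiplicatively by the coaction on $A_1=Z$. Then: 1. $\Bbbk{\sf s}$ is a one-dimensional $H$-subcomodule of $Z^{\otimes m}$; moreover, in the case of a right coaction ${\sf D}$ is invertible and $\rho({\sf s})={\sf s}\otimes{\sf D}^{-1}$ (resp., in the case of a left coaction $\rho({\sf s})={\sf D}\otimes{\sf s}$). 2. ${\sf D}=1_H$ if and only if $\Bbbk{\sf s}$ is the trivial right (resp., left) $H$-comodule. -/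

import Mathlib

open scoped TensorProduct

universe u

namespace SuperpotentialHopf

noncomputable section

/-! ### Twisted superpotentials -/

section Superpotential

variable {k Z : Type u} [Field k] [AddCommGroup Z] [Module k Z]

/-- The cyclic shift `z₁ ⊗ ⋯ ⊗ z_m ↦ z_m ⊗ z₁ ⊗ ⋯ ⊗ z_{m-1}` of `Z^{⊗ m}`. -/
def cyclicShift (m : ℕ) : (⨂[k]^m Z) →ₗ[k] (⨂[k]^m Z) :=
  (PiTensorProduct.reindex k (fun _ : Fin m => Z) (finRotate m)).toLinearMap

/-- The map `φ ⊗ id^{⊗ (m-1)}` of `Z^{⊗ m}`. -/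
def mapFirst (m : ℕ) (φ : Z →ₗ[k] Z) : (⨂[k]^m Z) →ₗ[k] (⨂[k]^m Z) :=
  PiTensorProduct.map (fun i : Fin m => if (i : ℕ) = 0 then φ else LinearMap.id)

/-- `s` is a twisted superpotential: `(φ ⊗ id^{⊗ (m-1)}) (c s) = s` for some `φ ∈ GL(Z)`. -/
def IsTwistedSuperpotential {m : ℕ} (s : ⨂[k]^m Z) : Prop :=
  ∃ φ : Z ≃ₗ[k] Z, mapFirst m φ.toLinearMap (cyclicShift m s) = s

/-- The contraction `ν ⊗ id^{⊗ m} : Z^{⊗ (m+1)} → Z^{⊗ m}` by a linear form `ν` on `Z`. -/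
def contractFirst (m : ℕ) (ν : Module.Dual k Z) : (⨂[k]^(m + 1) Z) →ₗ[k] (⨂[k]^m Z) :=
  PiTensorProduct.lift
    (LinearMap.uncurryLeft (ν.smulRight (PiTensorProduct.tprod k (s := fun _ : Fin m => Z))))

/-- `∂ W`, the subspace spanned by all `(ν ⊗ id^{⊗ m}) w` with `ν ∈ Z^*` and `w ∈ W`. -/
def partialSpace {m : ℕ} (W : Submodule k (⨂[k]^(m + 1) Z)) : Submodule k (⨂[k]^m Z) :=
  ⨆ ν : Module.Dual k Z, W.map (contractFirst m ν)

/-- The iterate `∂^r W ⊆ Z^{⊗ N}` for `W ⊆ Z^{⊗ (N + r)}`. -/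
def iterPartial (N : ℕ) :
    (r : ℕ) → Submodule k (⨂[k]^(N + r) Z) → Submodule k (⨂[k]^N Z)
  | 0, W => W
  | r + 1, W => iterPartial N r (partialSpace W)

/-- The space of relations `∂^{m - N}(k s)`, where `m = N + r`, as a subspace of `Z^{⊗ N} ⊆ T Z`. -/
def relationSpace (N r : ℕ) (s : ⨂[k]^(N + r) Z) : Submodule k (TensorAlgebra k Z) :=
  (iterPartial N r (Submodule.span k {s})).map TensorPower.toTensorAlgebra

/-- The superpotential algebra `A(s, N) = T Z / (∂^{m - N}(k s))`, where `m = N + r`. -/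
abbrev SuperpotentialAlgebra (N r : ℕ) (s : ⨂[k]^(N + r) Z) : Type u :=
  RingQuot (fun x y : TensorAlgebra k Z => x ∈ relationSpace N r s ∧ y = 0)

/-- The projection `T Z → A(s, N)`. -/
def quotientMap (N r : ℕ) (s : ⨂[k]^(N + r) Z) :
    TensorAlgebra k Z →ₐ[k] SuperpotentialAlgebra N r s :=
  RingQuot.mkAlgHom k _

/-- The subspace `Z^{⊗ j}` of `T Z`. -/
def tensorPiece (k Z : Type u) [Field k] [AddCommGroup Z] [Module k Z] (j : ℕ) :
    Submodule k (TensorAlgebra k Z) :=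
  LinearMap.range (TensorAlgebra.ι k : Z →ₗ[k] TensorAlgebra k Z) ^ j

/-- The degree `j` piece of `A(s, N)`. -/
def gradedPiece (N r : ℕ) (s : ⨂[k]^(N + r) Z) (j : ℕ) :
    Submodule k (SuperpotentialAlgebra N r s) :=
  (tensorPiece k Z j).map (quotientMap N r s).toLinearMap

theorem algHom_relation_eq_zero {N r : ℕ} {s : ⨂[k]^(N + r) Z} {B : Type u} [Semiring B]
    [Algebra k B] (f : TensorAlgebra k Z →ₐ[k] B)
    (hf : ∀ z : Fin N → Z, (List.ofFn fun i => f (TensorAlgebra.ι k (z i))).prod = 0)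
    {x : TensorAlgebra k Z} (hx : x ∈ relationSpace N r s) : f x = 0 := by
  obtain ⟨y, -, rfl⟩ := hx
  induction y using PiTensorProduct.induction_on with
  | smul_tprod c z =>
    rw [map_smul, map_smul, TensorPower.toTensorAlgebra_tprod, TensorAlgebra.tprod_apply,
      map_list_prod, List.map_ofFn]
    exact (congrArg (c • ·) (hf z)).trans (smul_zero c)
  | add a b ha hb => rw [map_add, map_add, ha, hb, add_zero]

/-- The augmentation `A(s, N) → k`, which kills `Z`. -/
def augmentation (N r : ℕ) (hN : 2 ≤ N) (s : ⨂[k]^(N + r) Z) :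
    SuperpotentialAlgebra N r s →ₐ[k] k :=
  RingQuot.liftAlgHom k ⟨TensorAlgebra.algebraMapInv, by
    rintro x y ⟨hx, rfl⟩
    rw [map_zero]
    refine algHom_relation_eq_zero _ (fun z => ?_) hx
    obtain ⟨n, rfl⟩ : ∃ n, N = n + 1 := ⟨N - 1, by omega⟩
    simp [TensorAlgebra.algebraMapInv]⟩

theorem toTrivSqZeroExt_relation_eq_zero (N r : ℕ) (hN : 2 ≤ N) (s : ⨂[k]^(N + r) Z)
    [Module kᵐᵒᵖ Z] [IsCentralScalar k Z] {x : TensorAlgebra k Z}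
    (hx : x ∈ relationSpace N r s) :
    (TensorAlgebra.toTrivSqZeroExt : TensorAlgebra k Z →ₐ[k] TrivSqZeroExt k Z) x = 0 := by
  refine algHom_relation_eq_zero _ (fun z => ?_) hx
  obtain ⟨n, rfl⟩ : ∃ n, N = n + 2 := ⟨N - 2, by omega⟩
  simp [List.ofFn_succ, ← mul_assoc]

/-- The projection of `A(s, N)` onto its piece of degree one, which is `Z`. -/
def degreeOne (N r : ℕ) (hN : 2 ≤ N) (s : ⨂[k]^(N + r) Z) :
    SuperpotentialAlgebra N r s →ₗ[k] Z :=
  letI : Module kᵐᵒᵖ Z := Module.compHom _ ((RingHom.id k).fromOpposite mul_comm)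
  haveI : IsCentralScalar k Z := ⟨fun _ _ => rfl⟩
  TrivSqZeroExt.sndHom k Z ∘ₗ
    (RingQuot.liftAlgHom k ⟨TensorAlgebra.toTrivSqZeroExt, by
      rintro x y ⟨hx, rfl⟩
      rw [map_zero]
      exact toTrivSqZeroExt_relation_eq_zero N r hN s hx⟩ :
      SuperpotentialAlgebra N r s →ₐ[k] TrivSqZeroExt k Z).toLinearMap

theorem degreeOne_quotientMap_ι (N r : ℕ) (hN : 2 ≤ N) (s : ⨂[k]^(N + r) Z) (z : Z) :
    degreeOne N r hN s (quotientMap N r s (TensorAlgebra.ι k z)) = z := by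
  let _ : Module kᵐᵒᵖ Z := Module.compHom _ ((RingHom.id k).fromOpposite mul_comm)
  have _ : IsCentralScalar k Z := ⟨fun _ _ => rfl⟩
  simp [degreeOne, quotientMap]

/-! ### `N`-Koszulity -/

/-- The number of tensor factors consumed by the `i`-th differential of the Koszul complex:
alternately `1` and `N - 1`. -/
def koszulStep (N i : ℕ) : ℕ := if Even i then 1 else N - 1

/-- The internal degree `δ(i)` of the `i`-th term of the Koszul complex:
`δ(2 j) = N j` and `δ(2 j + 1) = N j + 1`. -/
def koszulDegree (N : ℕ) : ℕ → ℕ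
  | 0 => 0
  | i + 1 => koszulStep N i + koszulDegree N i

/-- The subspace `⋂_{a + N + b = j} Z^{⊗ a} ⊗ R ⊗ Z^{⊗ b}` of `Z^{⊗ j}`, which is `(A^!_j)^*`
(all of `Z^{⊗ j}` if `j < N`). -/
def koszulSpace (N r : ℕ) (s : ⨂[k]^(N + r) Z) (j : ℕ) : Submodule k (⨂[k]^j Z) :=
  ⨅ (a : ℕ) (b : ℕ) (_ : a + N + b = j),
    (tensorPiece k Z a * relationSpace N r s * tensorPiece k Z b).comap
      TensorPower.toTensorAlgebra

/-- The map `A ⊗ Z^{⊗ (p + j)} → A ⊗ Z^{⊗ j}` multiplying the first `p` tensor factors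
into `A`. -/
def koszulDifferential (N r : ℕ) (s : ⨂[k]^(N + r) Z) (p j : ℕ) :
    SuperpotentialAlgebra N r s ⊗[k] (⨂[k]^(p + j) Z) →ₗ[k]
      SuperpotentialAlgebra N r s ⊗[k] (⨂[k]^j Z) :=
  LinearMap.rTensor (⨂[k]^j Z)
      (LinearMap.mul' k (SuperpotentialAlgebra N r s) ∘ₗ
        LinearMap.lTensor (SuperpotentialAlgebra N r s)
          ((quotientMap N r s).toLinearMap ∘ₗ
            (TensorPower.toTensorAlgebra : (⨂[k]^p Z) →ₗ[k] TensorAlgebra k Z))) ∘ₗ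
    (TensorProduct.assoc k (SuperpotentialAlgebra N r s) (⨂[k]^p Z)
      (⨂[k]^j Z)).symm.toLinearMap ∘ₗ
    LinearMap.lTensor (SuperpotentialAlgebra N r s)
      (TensorPower.mulEquiv (R := k) (M := Z) (n := p) (m := j)).symm.toLinearMap

/-- The `i`-th term `A ⊗ (A^!_{δ(i)})^*` of the Koszul complex, inside `A ⊗ Z^{⊗ δ(i)}`. -/
def koszulTerm (N r : ℕ) (s : ⨂[k]^(N + r) Z) (i : ℕ) :
    Submodule k (SuperpotentialAlgebra N r s ⊗[k] (⨂[k]^(koszulDegree N i) Z)) :=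
  LinearMap.range (LinearMap.lTensor (SuperpotentialAlgebra N r s)
    (koszulSpace N r s (koszulDegree N i)).subtype)

/-- The differential from the `(i + 1)`-st to the `i`-th term of the Koszul complex. -/
def koszulD (N r : ℕ) (s : ⨂[k]^(N + r) Z) (i : ℕ) :
    SuperpotentialAlgebra N r s ⊗[k] (⨂[k]^(koszulDegree N (i + 1)) Z) →ₗ[k]
      SuperpotentialAlgebra N r s ⊗[k] (⨂[k]^(koszulDegree N i) Z) :=
  koszulDifferential N r s (koszulStep N i) (koszulDegree N i)

/-- `A(s, N)` is `N`-Koszul: its Koszul complex is exact in all positive homological degrees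
(its cokernel in degree zero is always `k`). -/
def IsNKoszul (N r : ℕ) (s : ⨂[k]^(N + r) Z) : Prop :=
  ∀ i : ℕ, ∀ x ∈ koszulTerm N r s (i + 1),
    koszulD N r s i x = 0 ↔ ∃ y ∈ koszulTerm N r s (i + 2), koszulD N r s (i + 1) y = x

end Superpotential

/-! ### Artin-Schelter regularity -/

section ASRegular

open CategoryTheory

/-- The trivial left module `k` over an augmented algebra. -/
abbrev trivialModule {k A : Type u} [Field k] [Ring A] [Algebra k A] (ε : A →ₐ[k] k) :
    ModuleCat.{u} A :=
  (ModuleCat.restrictScalars (ε : A →+* k)).obj (ModuleCat.of k k)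

/-- The left-module half of Artin-Schelter regularity of dimension `d`: left global dimension `d`,
left injective dimension `d`, and `Ext^i_A(k, A)` is `k` for `i = d` and zero otherwise. -/
structure IsLeftASRegular {k A : Type u} [Field k] [Ring A] [Algebra k A] (ε : A →ₐ[k] k)
    (d : ℕ) : Prop where
  gldim_le : ∀ M : ModuleCat.{u} A, HasProjectiveDimensionLT M (d + 1)
  le_gldim : ∃ M : ModuleCat.{u} A, ¬ HasProjectiveDimensionLT M d
  injdim_le : HasInjectiveDimensionLT (ModuleCat.of A A) (d + 1)
  le_injdim : ¬ HasInjectiveDimensionLT (ModuleCat.of A A) d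
  ext_eq_zero : ∀ i : ℕ, i ≠ d → Subsingleton (Abelian.Ext (trivialModule ε) (ModuleCat.of A A) i)
  ext_one_dim : Module.finrank k (Abelian.Ext (trivialModule ε) (ModuleCat.of A A) d) = 1

/-- A connected `ℕ`-graded algebra `A` with graded pieces `𝒜 i` and augmentation `ε` is
Artin-Schelter regular of dimension `d`. Right modules are left modules over `Aᵐᵒᵖ`. -/
structure IsASRegular {k A : Type u} [Field k] [Ring A] [Algebra k A]
    (𝒜 : ℕ → Submodule k A) (ε : A →ₐ[k] k) (d : ℕ) : Prop where
  graded_mul : SetLike.GradedMonoid 𝒜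
  graded_sum : DirectSum.IsInternal 𝒜
  connected : 𝒜 0 = 1
  augmentation_pos : ∀ i : ℕ, 0 < i → ∀ a ∈ 𝒜 i, ε a = 0
  left : IsLeftASRegular ε d
  right : IsLeftASRegular (ε.fromOpposite (fun x y => mul_comm (ε x) (ε y))) d

end ASRegular

/-! ### Coactions -/

section Coaction

variable {k : Type u} [Field k]
variable {H : Type u} [Ring H] [HopfAlgebra k H]

/-- `δ : M → M ⊗ H` is a right `H`-comodule structure on `M`. -/
structure IsRightCoaction {M : Type u} [AddCommGroup M] [Module k M]
    (δ : M →ₗ[k] M ⊗[k] H) : Prop where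
  coassoc : (TensorProduct.assoc k M H H).toLinearMap ∘ₗ LinearMap.rTensor H δ ∘ₗ δ =
    LinearMap.lTensor M (Coalgebra.comul (R := k) (A := H)) ∘ₗ δ
  counit : (TensorProduct.rid k M).toLinearMap ∘ₗ
    LinearMap.lTensor M (Coalgebra.counit (R := k) (A := H)) ∘ₗ δ = LinearMap.id

/-- `δ : M → H ⊗ M` is a left `H`-comodule structure on `M`. -/
structure IsLeftCoaction {M : Type u} [AddCommGroup M] [Module k M]
    (δ : M →ₗ[k] H ⊗[k] M) : Prop where
  coassoc : (TensorProduct.assoc k H H M).toLinearMap ∘ₗ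
      LinearMap.rTensor M (Coalgebra.comul (R := k) (A := H)) ∘ₗ δ =
    LinearMap.lTensor H δ ∘ₗ δ
  counit : (TensorProduct.lid k M).toLinearMap ∘ₗ
    LinearMap.rTensor M (Coalgebra.counit (R := k) (A := H)) ∘ₗ δ = LinearMap.id

/-- The subspace `W` satisfies `δ W ⊆ W ⊗ H`. -/
def IsRightSubcomodule {M : Type u} [AddCommGroup M] [Module k M]
    (δ : M →ₗ[k] M ⊗[k] H) (W : Submodule k M) : Prop :=
  ∀ w ∈ W, δ w ∈ LinearMap.range (LinearMap.rTensor H W.subtype)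

/-- The subspace `W` satisfies `δ W ⊆ H ⊗ W`. -/
def IsLeftSubcomodule {M : Type u} [AddCommGroup M] [Module k M]
    (δ : M →ₗ[k] H ⊗[k] M) (W : Submodule k M) : Prop :=
  ∀ w ∈ W, δ w ∈ LinearMap.range (LinearMap.lTensor H W.subtype)

variable {A : Type u} [Ring A] [Algebra k A]

/-- `ρ` makes `A` a right `H`-comodule algebra, preserving the grading with pieces `𝒜 i`. -/
structure IsGradedRightCoaction (𝒜 : ℕ → Submodule k A) (ρ : A →ₐ[k] A ⊗[k] H) : Prop where
  coaction : IsRightCoaction ρ.toLinearMap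
  graded : ∀ i, IsRightSubcomodule ρ.toLinearMap (𝒜 i)

/-- `ρ` makes `A` a left `H`-comodule algebra, preserving the grading with pieces `𝒜 i`. -/
structure IsGradedLeftCoaction (𝒜 : ℕ → Submodule k A) (ρ : A →ₐ[k] H ⊗[k] A) : Prop where
  coaction : IsLeftCoaction ρ.toLinearMap
  graded : ∀ i, IsLeftSubcomodule ρ.toLinearMap (𝒜 i)

/-! ### Resolutions of the trivial module by Hopf modules, and the homological codeterminant -/

/-- A resolution `⋯ → P₁ → P₀ → k → 0` of the trivial left `A`-module by projective left
`A`-modules. -/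
structure ProjResolution (ε : A →ₐ[k] k) where
  /-- The terms. -/
  P : ℕ → Type u
  [addCommGroup : ∀ i, AddCommGroup (P i)]
  [moduleBase : ∀ i, Module k (P i)]
  [moduleAlg : ∀ i, Module A (P i)]
  [tower : ∀ i, IsScalarTower k A (P i)]
  projective : ∀ i, Module.Projective A (P i)
  /-- The differentials. -/
  diff : ∀ i, P (i + 1) →ₗ[A] P i
  /-- The map onto `k`. -/
  aug : P 0 →ₗ[k] k
  aug_smul : ∀ (a : A) (p : P 0), aug (a • p) = ε a * aug p
  aug_surjective : Function.Surjective aug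
  exact_zero : Function.Exact (diff 0) aug
  exact_succ : ∀ i, Function.Exact (diff (i + 1)) (diff i)

attribute [instance] ProjResolution.addCommGroup ProjResolution.moduleBase
  ProjResolution.moduleAlg ProjResolution.tower

namespace ProjResolution

variable {ε : A →ₐ[k] k} (Q : ProjResolution ε)

/-- `f` is `A`-linear to the vector space `V` with trivial action, that is,
`f` belongs to `Hom_A(Pᵢ, V)`. -/
def IsCochain {V : Type u} [AddCommGroup V] [Module k V] {i : ℕ} (f : Q.P i →ₗ[k] V) : Prop :=
  ∀ (a : A) (p : Q.P i), f (a • p) = ε a • f p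

/-- `f ∈ Hom_A(Pᵢ, V)` is a cocycle. -/
def IsCocycle {V : Type u} [AddCommGroup V] [Module k V] {i : ℕ} (f : Q.P i →ₗ[k] V) : Prop :=
  Q.IsCochain f ∧ ∀ p, f (Q.diff i p) = 0

/-- `f ∈ Hom_A(Pᵢ, V)` is a coboundary. -/
def IsCoboundary {V : Type u} [AddCommGroup V] [Module k V] :
    {i : ℕ} → (Q.P i →ₗ[k] V) → Prop
  | 0, f => f = 0
  | i + 1, f => ∃ b : Q.P i →ₗ[k] V, Q.IsCochain b ∧ ∀ p, f p = b (Q.diff i p)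

end ProjResolution

/-- A projective resolution of `k` in the category of left-right `(A, H)`-Hopf modules, where `A`
is a right `H`-comodule algebra via `ρ`: the terms carry right coactions with
`(a p)₀ ⊗ (a p)₁ = a₀ p₀ ⊗ a₁ p₁`, and all maps are comodule maps. -/
structure RightHopfResolution (ρ : A →ₐ[k] A ⊗[k] H) (ε : A →ₐ[k] k) extends
    ProjResolution ε where
  /-- The coactions on the terms. -/
  coact : ∀ i, P i →ₗ[k] P i ⊗[k] H
  isCoaction : ∀ i, IsRightCoaction (coact i)
  coact_smul : ∀ i (a : A) (p : P i), coact i (a • p) =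
    TensorProduct.map₂ (Algebra.lsmul k k (P i)).toLinearMap (LinearMap.mul k H)
      (ρ a) (coact i p)
  coact_diff : ∀ i (p : P (i + 1)), coact i (diff i p) =
    LinearMap.rTensor H ((diff i).restrictScalars k) (coact (i + 1) p)
  coact_aug : ∀ p : P 0, LinearMap.rTensor H aug (coact 0 p) = aug p ⊗ₜ[k] (1 : H)

/-- A projective resolution of `k` in the category of left-left `(A, H)`-Hopf modules, where `A`
is a left `H`-comodule algebra via `ρ`: the terms carry left coactions with
`(a p)₋₁ ⊗ (a p)₀ = a₋₁ p₋₁ ⊗ a₀ p₀`, and all maps are comodule maps. -/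
structure LeftHopfResolution (ρ : A →ₐ[k] H ⊗[k] A) (ε : A →ₐ[k] k) extends
    ProjResolution ε where
  /-- The coactions on the terms. -/
  coact : ∀ i, P i →ₗ[k] H ⊗[k] P i
  isCoaction : ∀ i, IsLeftCoaction (coact i)
  coact_smul : ∀ i (a : A) (p : P i), coact i (a • p) =
    TensorProduct.map₂ (LinearMap.mul k H) (Algebra.lsmul k k (P i)).toLinearMap
      (ρ a) (coact i p)
  coact_diff : ∀ i (p : P (i + 1)), coact i (diff i p) =
    LinearMap.lTensor H ((diff i).restrictScalars k) (coact (i + 1) p)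
  coact_aug : ∀ p : P 0, LinearMap.lTensor H aug (coact 0 p) = (1 : H) ⊗ₜ[k] aug p

/-- The coaction on cochains `f : Pᵢ → k` that is dual to the coaction of `Pᵢ` and uses the
antipode `S`; its value `∑ S(h) ⊗ f'` is encoded by the `H`-valued cochain
`p ↦ ∑ f'(p) S(h)`, which is `p ↦ f(p₀) S(p₁)`. -/
def RightHopfResolution.dualCoact {ρ : A →ₐ[k] A ⊗[k] H} {ε : A →ₐ[k] k}
    (Q : RightHopfResolution ρ ε) {i : ℕ} (f : Q.P i →ₗ[k] k) : Q.P i →ₗ[k] H :=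
  HopfAlgebra.antipode k ∘ₗ (TensorProduct.lid k H).toLinearMap ∘ₗ
    LinearMap.rTensor H f ∘ₗ Q.coact i

/-- The coaction on cochains `f : Pᵢ → k` that is dual to the coaction of `Pᵢ` and uses the
antipode `S`, encoded by the `H`-valued cochain `p ↦ f(p₀) S(p₋₁)`. -/
def LeftHopfResolution.dualCoact {ρ : A →ₐ[k] H ⊗[k] A} {ε : A →ₐ[k] k}
    (Q : LeftHopfResolution ρ ε) {i : ℕ} (f : Q.P i →ₗ[k] k) : Q.P i →ₗ[k] H :=
  HopfAlgebra.antipode k ∘ₗ (TensorProduct.rid k H).toLinearMap ∘ₗ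
    LinearMap.lTensor H f ∘ₗ Q.coact i

/-- `D` is the homological codeterminant of the right coaction `ρ` of `H` on the Artin-Schelter
regular algebra `A` of dimension `d`: the class `e` of a cocycle that is not a coboundary, which
is a nonzero element of `Ext^d_A(k, k)`, satisfies `ρ(e) = D ⊗ e`. -/
def IsRightCodeterminant (ρ : A →ₐ[k] A ⊗[k] H) (ε : A →ₐ[k] k) (d : ℕ) (D : H) : Prop :=
  ∃ (Q : RightHopfResolution ρ ε) (e : Q.P d →ₗ[k] k),
    Q.IsCocycle e ∧ ¬ Q.IsCoboundary e ∧
      Q.IsCoboundary (Q.dualCoact e - e.smulRight D)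

/-- `D` is the homological codeterminant of the left coaction `ρ` of `H` on the Artin-Schelter
regular algebra `A` of dimension `d`: the class `e` of a cocycle that is not a coboundary, which
is a nonzero element of `Ext^d_A(k, k)`, satisfies `ρ(e) = e ⊗ D⁻¹`. -/
def IsLeftCodeterminant (ρ : A →ₐ[k] H ⊗[k] A) (ε : A →ₐ[k] k) (d : ℕ) (D : H) : Prop :=
  ∃ (Q : LeftHopfResolution ρ ε) (e : Q.P d →ₗ[k] k),
    Q.IsCocycle e ∧ ¬ Q.IsCoboundary e ∧
      ∃ U : Hˣ, (U : H) = D ∧ Q.IsCoboundary (Q.dualCoact e - e.smulRight ((U⁻¹ : Hˣ) : H))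

end Coaction

/-! ### The induced coactions on the tensor powers of `Z` -/

section Induced

variable {k Z H : Type u} [Field k] [AddCommGroup Z] [Module k Z] [Ring H] [HopfAlgebra k H]

/-- The right coaction on `T Z`, hence on each `Z^{⊗ j} ⊆ T Z`, that is multiplicative and
restricts on `Z` to the coaction on `A(s, N)₁ = Z`. -/
def tensorRightCoaction (N r : ℕ) (hN : 2 ≤ N) (s : ⨂[k]^(N + r) Z)
    (ρ : SuperpotentialAlgebra N r s →ₐ[k] SuperpotentialAlgebra N r s ⊗[k] H) :
    TensorAlgebra k Z →ₐ[k] TensorAlgebra k Z ⊗[k] H :=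
  TensorAlgebra.lift k
    (LinearMap.rTensor H (TensorAlgebra.ι k ∘ₗ degreeOne N r hN s) ∘ₗ ρ.toLinearMap ∘ₗ
      (quotientMap N r s).toLinearMap ∘ₗ TensorAlgebra.ι k)

/-- The left coaction on `T Z`, hence on each `Z^{⊗ j} ⊆ T Z`, that is multiplicative and
restricts on `Z` to the coaction on `A(s, N)₁ = Z`. -/
def tensorLeftCoaction (N r : ℕ) (hN : 2 ≤ N) (s : ⨂[k]^(N + r) Z)
    (ρ : SuperpotentialAlgebra N r s →ₐ[k] H ⊗[k] SuperpotentialAlgebra N r s) :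
    TensorAlgebra k Z →ₐ[k] H ⊗[k] TensorAlgebra k Z :=
  TensorAlgebra.lift k
    (LinearMap.lTensor H (TensorAlgebra.ι k ∘ₗ degreeOne N r hN s) ∘ₗ ρ.toLinearMap ∘ₗ
      (quotientMap N r s).toLinearMap ∘ₗ TensorAlgebra.ι k)

/-- The element `s` of `Z^{⊗ m}`, viewed in `T Z`. -/
abbrev inTensorAlgebra {m : ℕ} (s : ⨂[k]^m Z) : TensorAlgebra k Z :=
  TensorPower.toTensorAlgebra s

end Induced

end

end SuperpotentialHopf

/-! The coaction on the top cohomology can be read off the Koszul resolution, whose last term is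
generated by `s`. The coaction of `A` extends multiplicatively to `T Z`. It preserves each `Z^{⊗
j}`, and it preserves `R`, the degree `N` part of the kernel of `T Z → A`; so it preserves every
Koszul space `W_j`. Hence each term `A ⊗ W_{δ(i)}` carries a coaction compatible with all structure
maps.

The Koszul resolution is minimal, so regularity bounds its last term: the dual of `W_{δ(d)}` embeds
into the one-dimensional `Ext^d(k, A)` (`finrank_koszulSpace_le_one`). Twisted cyclic invariance
moves `R` through all positions, so `s` lies in `W_m` with `m = δ(d)`
(`IsTwistedSuperpotential.mem_koszulSpace`). If `s` were zero then so would be `R` and `W_m`, and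
there would be no nonzero class in degree `d`. So `W_m = k s`, and the coaction sends `s` to `s ⊗
h`; coassociativity and the counit make `h` group-like.

Let `Q` be the Hopf module resolution that computes the codeterminant, and `F` a chain map to it
from the Koszul resolution. `F` need not be colinear, but its defect is a null-homotopic chain map
into `Q ⊗ H` with `A` acting through `ρ`. Minimality kills the homotopy terms after applying a
cocycle `e` (`exists_chainMap_coact_eq`), so `y = F(1 ⊗ s)` satisfies `e(y₀) y₁ = e(y) h`.
Coboundaries vanish at `y` and `e(y) ≠ 0`, so comparing with the definition of the codeterminant
gives `S(h) = D` for right coactions and `S(h) = D⁻¹` for left ones. As `S(h) = h⁻¹`, this means `h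
= D⁻¹` and `h = D` respectively. The left case is reduced to the right one by flipping tensor
factors and passing to the co-opposite comultiplication. -/

namespace SuperpotentialHopf

/-! ### Subspaces `V ⊗ H` of `M ⊗ H`, detected by slices. -/

section TensorSubspaces

variable {k : Type u} [Field k]
variable {M M' H : Type u} [AddCommGroup M] [Module k M] [AddCommGroup M'] [Module k M']
  [AddCommGroup H] [Module k H]

/-- The slice `id ⊗ φ : M ⊗ H → M`. -/
noncomputable def slice (M : Type u) [AddCommGroup M] [Module k M] (φ : Module.Dual k H) :
    M ⊗[k] H →ₗ[k] M :=
  (TensorProduct.rid k M).toLinearMap ∘ₗ LinearMap.lTensor M φ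

@[simp]
theorem slice_tmul (φ : Module.Dual k H) (m : M) (h : H) : slice M φ (m ⊗ₜ[k] h) = φ h • m := by
  simp [slice]

theorem slice_rTensor (φ : Module.Dual k H) (f : M →ₗ[k] M') (x : M ⊗[k] H) :
    slice M' φ (LinearMap.rTensor H f x) = f (slice M φ x) := by
  induction x with
  | zero => simp
  | tmul m h => simp
  | add x y hx hy => rw [map_add, map_add, map_add, map_add, hx, hy]

/-- For a basis of `H`, the slices by coordinate forms are the coefficients of `x`. -/
theorem eq_zero_of_slice_eq_zero {x : M ⊗[k] H} (hx : ∀ φ : Module.Dual k H, slice M φ x = 0) :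
    x = 0 := by
  classical
  let b := Module.Basis.ofVectorSpace k H
  apply (TensorProduct.equivFinsuppOfBasisRight b).injective
  ext i
  rw [TensorProduct.equivFinsuppOfBasisRight_apply, map_zero]
  exact hx (b.coord i)

theorem range_rTensor_subtype (V : Submodule k M) :
    LinearMap.range (LinearMap.rTensor H V.subtype) = LinearMap.ker (LinearMap.rTensor H V.mkQ) :=
  (LinearMap.exact_iff.mp (rTensor_exact H
    (LinearMap.exact_subtype_mkQ V) V.mkQ_surjective)).symm

/-- An element of `M ⊗ H` lies in `V ⊗ H` if and only if all its slices lie in `V`. -/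
theorem mem_range_rTensor_iff (V : Submodule k M) (x : M ⊗[k] H) :
    x ∈ LinearMap.range (LinearMap.rTensor H V.subtype) ↔
      ∀ φ : Module.Dual k H, slice M φ x ∈ V := by
  constructor
  · rintro ⟨y, rfl⟩ φ
    rw [slice_rTensor]
    exact (slice V φ y).2
  · intro h
    rw [range_rTensor_subtype, LinearMap.mem_ker]
    refine eq_zero_of_slice_eq_zero fun φ => ?_
    rw [slice_rTensor]
    simpa using h φ

theorem tmul_mem_range_rTensor {V : Submodule k M} {v : M} (hv : v ∈ V) (h : H) :
    v ⊗ₜ[k] h ∈ LinearMap.range (LinearMap.rTensor H V.subtype) :=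
  ⟨(⟨v, hv⟩ : V) ⊗ₜ h, by simp⟩

/-- A linear map into `M ⊗ H` with values in `V ⊗ H` factors through `V ⊗ H`. -/
theorem exists_rTensor_comp_eq {V U : Type u} [AddCommGroup V] [Module k V] [AddCommGroup U]
    [Module k U] (i : V →ₗ[k] M) (hi : Function.Injective i) (g : U →ₗ[k] M ⊗[k] H)
    (hg : ∀ u, g u ∈ LinearMap.range (LinearMap.rTensor H (LinearMap.range i).subtype)) :
    ∃ g' : U →ₗ[k] V ⊗[k] H, LinearMap.rTensor H i ∘ₗ g' = g := by
  have hi' : Function.Injective (LinearMap.rTensor H i) :=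
    Module.Flat.rTensor_preserves_injective_linearMap i hi
  have hg' : ∀ u, g u ∈ LinearMap.range (LinearMap.rTensor H i) := by
    intro u
    obtain ⟨y, hy⟩ := hg u
    rw [← hy]
    refine ⟨LinearMap.rTensor H (LinearEquiv.ofInjective i hi).symm.toLinearMap y, ?_⟩
    rw [← LinearMap.comp_apply, ← LinearMap.rTensor_comp]
    congr 2
    ext v
    simp [← LinearEquiv.ofInjective_apply (h := hi)]
  refine ⟨(LinearEquiv.ofInjective _ hi').symm.toLinearMap ∘ₗ g.codRestrict _ hg', ?_⟩
  ext u
  simp [← LinearEquiv.ofInjective_apply (h := hi')]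

end TensorSubspaces

/-! ### Products of subspaces preserved by a multiplicative coaction. -/

section MulSubspaces

variable {k : Type u} [Field k] {T H : Type u} [Ring T] [Algebra k T] [Ring H] [Algebra k H]

theorem mul_mem_range_rTensor {V V' : Submodule k T} {x y : T ⊗[k] H}
    (hx : x ∈ LinearMap.range (LinearMap.rTensor H V.subtype))
    (hy : y ∈ LinearMap.range (LinearMap.rTensor H V'.subtype)) :
    x * y ∈ LinearMap.range (LinearMap.rTensor H (V * V').subtype) := by
  obtain ⟨x, rfl⟩ := hx
  obtain ⟨y, rfl⟩ := hy
  induction x with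
  | zero => simp
  | add x x' hx hx' => rw [map_add, add_mul]; exact add_mem hx hx'
  | tmul v h =>
    induction y with
    | zero => simp
    | add y y' hy hy' => rw [map_add, mul_add]; exact add_mem hy hy'
    | tmul v' h' =>
      simpa using tmul_mem_range_rTensor (Submodule.mul_mem_mul v.2 v'.2) (h * h')

theorem IsRightSubcomodule.slice_mem {k M H : Type u} [Field k] [AddCommGroup M] [Module k M]
    [Ring H] [HopfAlgebra k H] {δ : M →ₗ[k] M ⊗[k] H} {V : Submodule k M}
    (hV : IsRightSubcomodule δ V) {w : M} (hw : w ∈ V) (φ : Module.Dual k H) :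
    slice M φ (δ w) ∈ V :=
  (mem_range_rTensor_iff _ _).mp (hV w hw) φ

theorem IsRightSubcomodule.of_slice_mem {k M H : Type u} [Field k] [AddCommGroup M] [Module k M]
    [Ring H] [HopfAlgebra k H] {δ : M →ₗ[k] M ⊗[k] H} {V : Submodule k M}
    (hV : ∀ w ∈ V, ∀ φ : Module.Dual k H, slice M φ (δ w) ∈ V) : IsRightSubcomodule δ V :=
  fun w hw => (mem_range_rTensor_iff _ _).mpr (hV w hw)

/-- A product of subspaces that an algebra map `δ : T → T ⊗ H` preserves is preserved. -/
theorem IsRightSubcomodule.mul {k T H : Type u} [Field k] [Ring T] [Algebra k T] [Ring H]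
    [HopfAlgebra k H] {δ : T →ₐ[k] T ⊗[k] H} {V V' : Submodule k T}
    (hV : IsRightSubcomodule δ.toLinearMap V) (hV' : IsRightSubcomodule δ.toLinearMap V') :
    IsRightSubcomodule δ.toLinearMap (V * V') := by
  intro w hw
  induction hw using Submodule.mul_induction_on' with
  | mem_mul_mem x hx y hy =>
    have := mul_mem_range_rTensor (hV x hx) (hV' y hy)
    simpa using this
  | add x _ y _ hx hy => rw [map_add]; exact add_mem hx hy

theorem IsRightSubcomodule.one {k T H : Type u} [Field k] [Ring T] [Algebra k T] [Ring H]
    [HopfAlgebra k H] {δ : T →ₐ[k] T ⊗[k] H} :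
    IsRightSubcomodule δ.toLinearMap (1 : Submodule k T) := by
  intro w hw
  obtain ⟨c, rfl⟩ := Submodule.mem_one.mp hw
  have : δ.toLinearMap (algebraMap k T c) = (algebraMap k T c) ⊗ₜ 1 := by
    simp [Algebra.TensorProduct.algebraMap_apply]
  rw [this]
  exact tmul_mem_range_rTensor hw 1

theorem IsRightSubcomodule.pow {k T H : Type u} [Field k] [Ring T] [Algebra k T] [Ring H]
    [HopfAlgebra k H] {δ : T →ₐ[k] T ⊗[k] H} {V : Submodule k T}
    (hV : IsRightSubcomodule δ.toLinearMap V) (n : ℕ) :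
    IsRightSubcomodule δ.toLinearMap (V ^ n) := by
  induction n with
  | zero => rw [pow_zero]; exact .one
  | succ n ih => rw [pow_succ]; exact ih.mul hV

end MulSubspaces

/-! ### Chain maps, homotopies and minimal resolutions. -/

section Comparison

variable {k : Type u} [Field k] {A : Type u} [Ring A] [Algebra k A] {ε : A →ₐ[k] k}

namespace ProjResolution

attribute [instance] ProjResolution.projective

theorem exists_lift (P : ProjResolution ε) {i : ℕ} {X Y Y' : Type u} [AddCommGroup X] [Module A X]
    [AddCommGroup Y] [Module A Y] [AddCommGroup Y'] [Module A Y'] {f : X →ₗ[A] Y} {g : Y →ₗ[A] Y'}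
    (hfg : Function.Exact f g) (h : P.P i →ₗ[A] Y) (hh : ∀ x, g (h x) = 0) :
    ∃ l : P.P i →ₗ[A] X, ∀ x, f (l x) = h x := by
  have hr : ∀ x, h x ∈ LinearMap.range f := fun x => (hfg _).mp (hh x)
  obtain ⟨l, hl⟩ := Module.projective_lifting_property f.rangeRestrict (h.codRestrict _ hr)
    f.surjective_rangeRestrict
  exact ⟨l, fun x => congrArg Subtype.val (LinearMap.congr_fun hl x)⟩

theorem diff_diff (P : ProjResolution ε) (i : ℕ) (x : P.P (i + 2)) :
    P.diff i (P.diff (i + 1) x) = 0 :=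
  (P.exact_succ i).apply_apply_eq_zero x

theorem aug_diff (P : ProjResolution ε) (x : P.P 1) : P.aug (P.diff 0 x) = 0 :=
  P.exact_zero.apply_apply_eq_zero x

/-- A chain map over the identity of `k` from a resolution by projectives to a resolution. -/
theorem exists_chainMap (P Q : ProjResolution ε) :
    ∃ f : ∀ i, P.P i →ₗ[A] Q.P i, (∀ x, Q.aug (f 0 x) = P.aug x) ∧
      ∀ i x, f i (P.diff i x) = Q.diff i (f (i + 1) x) := by
  let _ : Module A k := Module.compHom k (ε : A →+* k)
  let augA (R : ProjResolution ε) : R.P 0 →ₗ[A] k :=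
    { toFun := R.aug, map_add' := map_add _, map_smul' := R.aug_smul }
  obtain ⟨f₀, hf₀⟩ := Module.projective_lifting_property (augA Q) (augA P) Q.aug_surjective
  obtain ⟨f₁, hf₁⟩ := P.exists_lift (f := Q.diff 0) (g := augA Q) Q.exact_zero
    (f₀ ∘ₗ P.diff 0) (fun x =>
      (LinearMap.congr_fun hf₀ (P.diff 0 x)).trans (P.aug_diff x))
  -- The recursion carries two consecutive components together with their commuting square, which is
  -- exactly what the construction of the next component needs.
  have step : ∀ n (p : {p : (P.P n →ₗ[A] Q.P n) × (P.P (n + 1) →ₗ[A] Q.P (n + 1)) //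
      ∀ x, p.1 (P.diff n x) = Q.diff n (p.2 x)}),
      ∃ g : P.P (n + 2) →ₗ[A] Q.P (n + 2), ∀ x, p.1.2 (P.diff (n + 1) x) =
        Q.diff (n + 1) (g x) := by
    rintro n ⟨⟨g₀, g₁⟩, hg⟩
    obtain ⟨g, hg'⟩ := P.exists_lift (Q.exact_succ n) (g₁ ∘ₗ P.diff (n + 1)) (fun x => by
      change Q.diff n (g₁ _) = 0
      rw [← hg, P.diff_diff, map_zero])
    exact ⟨g, fun x => (hg' x).symm⟩
  choose g hg using step
  let F : ∀ n, {p : (P.P n →ₗ[A] Q.P n) × (P.P (n + 1) →ₗ[A] Q.P (n + 1)) //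
      ∀ x, p.1 (P.diff n x) = Q.diff n (p.2 x)} := fun n =>
    Nat.rec ⟨(f₀, f₁), fun x => (hf₁ x).symm⟩ (fun n p => ⟨(p.1.2, g n p), hg n p⟩) n
  exact ⟨fun n => (F n).1.1, LinearMap.congr_fun hf₀, fun i x => (F i).2 x⟩

/-- A chain map from a complex of projectives to an exact complex is null-homotopic if it
is zero on homology in degree zero. -/
theorem exists_nullHomotopy (P : ProjResolution ε) {Y : ℕ → Type u} [∀ i, AddCommGroup (Y i)]
    [∀ i, Module A (Y i)] (dY : ∀ i, Y (i + 1) →ₗ[A] Y i)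
    (hY : ∀ i, Function.Exact (dY (i + 1)) (dY i)) (g : ∀ i, P.P i →ₗ[A] Y i)
    (hg : ∀ i x, g i (P.diff i x) = dY i (g (i + 1) x))
    (hg₀ : ∀ x, g 0 x ∈ LinearMap.range (dY 0)) (n : ℕ) :
    ∃ (t : P.P n →ₗ[A] Y (n + 1)) (t' : P.P (n + 1) →ₗ[A] Y (n + 2)),
      ∀ x, g (n + 1) x = dY (n + 1) (t' x) + t (P.diff n x) := by
  have step : ∀ n (t : P.P n →ₗ[A] Y (n + 1)),
      (∀ x, dY n (t (P.diff n x)) = dY n (g (n + 1) x)) →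
      ∃ t' : P.P (n + 1) →ₗ[A] Y (n + 2),
        ∀ x, g (n + 1) x = dY (n + 1) (t' x) + t (P.diff n x) := by
    intro n t ht
    obtain ⟨t', ht'⟩ := P.exists_lift (hY n) (g (n + 1) - t ∘ₗ P.diff n) (fun x => by
      simp [ht])
    exact ⟨t', fun x => by simp [ht']⟩
  -- The induction keeps only this consequence of the homotopy relation: `g (n + 1) - t ∘ d` takes
  -- values in cycles. It is all that is needed to find the next component.
  have key : ∀ n, ∃ t : P.P n →ₗ[A] Y (n + 1),
      ∀ x, dY n (t (P.diff n x)) = dY n (g (n + 1) x) := by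
    intro n
    induction n with
    | zero =>
      obtain ⟨t, ht⟩ := Module.projective_lifting_property (dY 0).rangeRestrict
        ((g 0).codRestrict _ hg₀) (dY 0).surjective_rangeRestrict
      refine ⟨t, fun x => ?_⟩
      rw [← hg]
      exact congrArg Subtype.val (LinearMap.congr_fun ht (P.diff 0 x))
    | succ n ih =>
      obtain ⟨t, ht⟩ := ih
      obtain ⟨t', ht'⟩ := step n t ht
      refine ⟨t', fun x => ?_⟩
      have := ht' (P.diff (n + 1) x)
      rw [P.diff_diff, map_zero, add_zero] at this
      rw [← this, hg]
  obtain ⟨t, ht⟩ := key n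
  exact ⟨t, step n t ht⟩

/-- A resolution is minimal if all its coboundaries vanish. -/
def IsMinimal (P : ProjResolution ε) : Prop :=
  ∀ (V : Type u) [AddCommGroup V] [Module k V] (i : ℕ) (b : P.P i →ₗ[k] V),
    P.IsCochain b → ∀ p, b (P.diff i p) = 0

theorem IsCochain.comp {P Q : ProjResolution ε} {V : Type u} [AddCommGroup V] [Module k V] {i j : ℕ}
    {b : Q.P i →ₗ[k] V} (hb : Q.IsCochain b) (f : P.P j →ₗ[A] Q.P i) :
    P.IsCochain (b ∘ₗ f.restrictScalars k) := fun a p => by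
  simp [hb a]

/-- A chain map pulls coboundaries back to coboundaries, and a minimal resolution has no nonzero
ones. -/
theorem IsMinimal.coboundary_comp_eq_zero {P Q : ProjResolution ε} (hP : P.IsMinimal)
    {f : ∀ i, P.P i →ₗ[A] Q.P i} (hf : ∀ i x, f i (P.diff i x) = Q.diff i (f (i + 1) x))
    {V : Type u} [AddCommGroup V] [Module k V] {i : ℕ} {b : Q.P i →ₗ[k] V}
    (hb : Q.IsCoboundary b) (x : P.P i) : b (f i x) = 0 := by
  cases i with
  | zero => rw [show b = 0 from hb]; rfl
  | succ i =>
    obtain ⟨c, hc, hbc⟩ := hb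
    rw [hbc, ← hf]
    exact hP V i _ (hc.comp (f i)) x

/-- A cocycle that is not a coboundary does not vanish along a chain map. -/
theorem exists_apply_chainMap_ne_zero {P Q : ProjResolution ε}
    {f : ∀ i, P.P i →ₗ[A] Q.P i} (hf₀ : ∀ x, Q.aug (f 0 x) = P.aug x)
    (hf : ∀ i x, f i (P.diff i x) = Q.diff i (f (i + 1) x)) {n : ℕ}
    {e : Q.P (n + 1) →ₗ[k] k} (he : Q.IsCocycle e) (he' : ¬ Q.IsCoboundary e) :
    ∃ x, e (f (n + 1) x) ≠ 0 := by
  by_contra! h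
  obtain ⟨φ, hφ₀, hφ⟩ := exists_chainMap Q P
  -- `f ∘ φ` is homotopic to the identity of `Q`. If `e` vanishes along `f`, then applying `e` to
  -- the homotopy relation leaves `e = e ∘ t ∘ d`, a coboundary.
  obtain ⟨t, t', ht⟩ := Q.exists_nullHomotopy Q.diff Q.exact_succ
    (fun i => LinearMap.id - f i ∘ₗ φ i) (fun i x => by simp [hφ, hf])
    (fun x => by
      refine (Q.exact_zero _).mp ?_
      simp [hf₀, hφ₀]) n
  refine he' ⟨e ∘ₗ t.restrictScalars k, he.1.comp t, fun p => ?_⟩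
  have := congrArg e (ht p)
  simpa [h, he.2] using this

end ProjResolution

/-! ### Comparison of coactions on two resolutions. -/

section Twisted

variable {H : Type u} [Ring H] [Algebra k H]

/-- The action of `A ⊗ H` on `M ⊗ H`. -/
noncomputable abbrev tensorAct (A H M : Type u) [Ring A] [Algebra k A] [Ring H] [Algebra k H]
    [AddCommGroup M] [Module k M] [Module A M] [IsScalarTower k A M] :
    A ⊗[k] H →ₗ[k] M ⊗[k] H →ₗ[k] M ⊗[k] H :=
  TensorProduct.map₂ (Algebra.lsmul k k M).toLinearMap (LinearMap.mul k H)

variable {M : Type u} [AddCommGroup M] [Module k M] [Module A M] [IsScalarTower k A M]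

theorem tensorAct_one (x : M ⊗[k] H) : tensorAct A H M 1 x = x := by
  induction x with
  | zero => simp
  | tmul m h => simp [tensorAct, Algebra.TensorProduct.one_def]
  | add x y hx hy => rw [map_add, hx, hy]

theorem tensorAct_mul (α β : A ⊗[k] H) (x : M ⊗[k] H) :
    tensorAct A H M (α * β) x = tensorAct A H M α (tensorAct A H M β x) := by
  induction α with
  | zero => simp
  | add α α' h h' => simp only [add_mul, map_add, LinearMap.add_apply, h, h']
  | tmul a h =>
    induction β with
    | zero => simp
    | add β β' h h' => simp only [mul_add, map_add, LinearMap.add_apply, h, h']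
    | tmul b h' =>
      induction x with
      | zero => simp
      | add x y hx hy => simp only [map_add, hx, hy]
      | tmul m h'' => simp [tensorAct, mul_assoc]

theorem rTensor_tensorAct {M' : Type u} [AddCommGroup M'] [Module k M'] [Module A M']
    [IsScalarTower k A M'] (f : M →ₗ[A] M') (α : A ⊗[k] H) (x : M ⊗[k] H) :
    LinearMap.rTensor H (f.restrictScalars k) (tensorAct A H M α x) =
      tensorAct A H M' α (LinearMap.rTensor H (f.restrictScalars k) x) := by
  induction α with
  | zero => simp
  | add α α' h h' => simp only [map_add, LinearMap.add_apply, h, h']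
  | tmul a h =>
    induction x with
    | zero => simp
    | add x y hx hy => simp only [map_add, hx, hy]
    | tmul m h'' => simp [tensorAct]

/-- `M ⊗ H` with `A` acting through `ρ : A → A ⊗ H`. -/
def TwistedTensor (_ρ : A →ₐ[k] A ⊗[k] H) (M : Type u) [AddCommGroup M] [Module k M] : Type u :=
  M ⊗[k] H

variable (ρ : A →ₐ[k] A ⊗[k] H)

noncomputable instance : AddCommGroup (TwistedTensor ρ M) :=
  inferInstanceAs (AddCommGroup (M ⊗[k] H))

noncomputable instance : Module A (TwistedTensor ρ M) where
  smul a x := tensorAct A H M (ρ a) x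
  one_smul (x : M ⊗[k] H) := by
    change tensorAct A H M (ρ 1) x = x
    rw [map_one, tensorAct_one]
  mul_smul a b (x : M ⊗[k] H) := by
    change tensorAct A H M (ρ (a * b)) x = tensorAct A H M (ρ a) (tensorAct A H M (ρ b) x)
    rw [map_mul, tensorAct_mul]
  smul_zero a := map_zero (tensorAct A H M (ρ a))
  smul_add a := map_add (tensorAct A H M (ρ a))
  add_smul a b (x : M ⊗[k] H) := by
    change tensorAct A H M (ρ (a + b)) x = tensorAct A H M (ρ a) x + tensorAct A H M (ρ b) x
    rw [map_add, map_add, LinearMap.add_apply]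
  zero_smul (x : M ⊗[k] H) := by
    change tensorAct A H M (ρ 0) x = 0
    rw [map_zero, map_zero, LinearMap.zero_apply]

/-- Coactions `P_i → P_i ⊗ H` on the terms of a resolution that are compatible with a map
`ρ : A → A ⊗ H` and with all structure maps. -/
structure CompatibleCoaction (P : ProjResolution ε) where
  /-- The coactions on the terms. -/
  coact : ∀ i, P.P i →ₗ[k] P.P i ⊗[k] H
  coact_smul : ∀ i (a : A) (p : P.P i), coact i (a • p) =
    tensorAct A H (P.P i) (ρ a) (coact i p)
  coact_diff : ∀ i (p : P.P (i + 1)), coact i (P.diff i p) =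
    LinearMap.rTensor H ((P.diff i).restrictScalars k) (coact (i + 1) p)
  coact_aug : ∀ p : P.P 0, LinearMap.rTensor H P.aug (coact 0 p) = P.aug p ⊗ₜ[k] (1 : H)

/-- Applied to `α = ρ a` with `(ε ⊗ id) (ρ a) = ε a`, this makes `e ⊗ id` an `A`-linear map from the
twisted module `M ⊗ H` to `H` with trivial action. -/
theorem lid_rTensor_tensorAct {V : Type u} [AddCommGroup V] [Module k V] {M : Type u}
    [AddCommGroup M] [Module k M] [Module A M] [IsScalarTower k A M]
    {e : M →ₗ[k] k} (he : ∀ (a : A) m, e (a • m) = ε a * e m) (α : A ⊗[k] H) (x : M ⊗[k] H) :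
    TensorProduct.lid k H (LinearMap.rTensor H e (tensorAct A H M α x)) =
      TensorProduct.lid k H (LinearMap.rTensor H ε.toLinearMap α) *
        TensorProduct.lid k H (LinearMap.rTensor H e x) := by
  induction α with
  | zero => simp
  | add α α' h h' => simp only [map_add, LinearMap.add_apply, h, h', add_mul]
  | tmul a h =>
    induction x with
    | zero => simp
    | add x y hx hy => simp only [map_add, hx, hy, mul_add]
    | tmul m h'' => simp [tensorAct, he, mul_smul, smul_comm (e m)]

/-- The coaction on the top cohomology class can be computed with any resolution by Hopf modules,
and on the nose with a minimal one. -/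
theorem exists_chainMap_coact_eq {P Q : ProjResolution ε}
    (hρ : ∀ a, TensorProduct.lid k H (LinearMap.rTensor H ε.toLinearMap (ρ a)) = ε a • (1 : H))
    (cP : CompatibleCoaction ρ P) (cQ : CompatibleCoaction ρ Q) (hP : P.IsMinimal) {n : ℕ}
    {e : Q.P (n + 1) →ₗ[k] k} (he : Q.IsCocycle e) (he' : ¬ Q.IsCoboundary e) :
    ∃ f : P.P (n + 1) →ₗ[A] Q.P (n + 1), (∃ x, e (f x) ≠ 0) ∧
      (∀ x, TensorProduct.lid k H (LinearMap.rTensor H e (cQ.coact (n + 1) (f x))) =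
        TensorProduct.lid k H (LinearMap.rTensor H (e ∘ₗ f.restrictScalars k)
          (cP.coact (n + 1) x))) ∧
      ∀ (V : Type u) [AddCommGroup V] [Module k V] (b : Q.P (n + 1) →ₗ[k] V),
        Q.IsCoboundary b → ∀ x, b (f x) = 0 := by
  obtain ⟨f, hf₀, hf⟩ := ProjResolution.exists_chainMap P Q
  refine ⟨f (n + 1), ProjResolution.exists_apply_chainMap_ne_zero hf₀ hf he he', fun x => ?_,
    fun V _ _ b hb x => hP.coboundary_comp_eq_zero hf hb x⟩
  let dY : ∀ i, TwistedTensor ρ (Q.P (i + 1)) →ₗ[A] TwistedTensor ρ (Q.P i) := fun i =>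
    { toFun := LinearMap.rTensor H ((Q.diff i).restrictScalars k)
      map_add' := map_add (LinearMap.rTensor H ((Q.diff i).restrictScalars k))
      map_smul' := fun a y => rTensor_tensorAct (Q.diff i) (ρ a) y }
  -- The failure of `f` to be colinear. It is `A`-linear for the action through `ρ`, since both
  -- coactions are compatible with `ρ`.
  let g : ∀ i, P.P i →ₗ[A] TwistedTensor ρ (Q.P i) := fun i =>
    { toFun := fun x => cQ.coact i (f i x) -
        LinearMap.rTensor H ((f i).restrictScalars k) (cP.coact i x)
      map_add' := fun x y => by
        simp only [map_add]
        exact add_sub_add_comm _ _ _ _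
      map_smul' := fun a x => by
        rw [map_smul, cQ.coact_smul, cP.coact_smul, rTensor_tensorAct, ← map_sub]
        rfl }
  -- `Q ⊗ H` stays exact because `H` is flat over `k`. In degree zero both terms of `g` have the
  -- same image `aug ⊗ 1` under the augmentation, so `g` induces zero on homology.
  obtain ⟨t, t', ht⟩ := P.exists_nullHomotopy dY
    (fun i => Module.Flat.rTensor_exact H (Q.exact_succ i)) g
    (fun i x => by
      change cQ.coact i (f i _) - LinearMap.rTensor H ((f i).restrictScalars k) (cP.coact i _) =
        LinearMap.rTensor H ((Q.diff i).restrictScalars k) (cQ.coact (i + 1) (f (i + 1) x) -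
        LinearMap.rTensor H ((f (i + 1)).restrictScalars k) (cP.coact (i + 1) x))
      rw [hf, cQ.coact_diff, cP.coact_diff, map_sub, ← LinearMap.rTensor_comp_apply,
        ← LinearMap.rTensor_comp_apply]
      congr 3
      ext y
      exact hf i y)
    (fun x => by
      refine (Module.Flat.rTensor_exact H
        (f := (Q.diff 0).restrictScalars k) (g := Q.aug) Q.exact_zero _).mp ?_
      change LinearMap.rTensor H Q.aug (cQ.coact 0 (f 0 x) -
        LinearMap.rTensor H ((f 0).restrictScalars k) (cP.coact 0 x)) = 0
      rw [map_sub, cQ.coact_aug, ← LinearMap.comp_apply, ← LinearMap.rTensor_comp,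
        show Q.aug ∘ₗ (f 0).restrictScalars k = P.aug from LinearMap.ext hf₀, cP.coact_aug,
        hf₀, sub_self]) n
  let E : Q.P (n + 1) ⊗[k] H →ₗ[k] H :=
    (TensorProduct.lid k H).toLinearMap ∘ₗ LinearMap.rTensor H e
  have hE : ∀ (a : A) (y : TwistedTensor ρ (Q.P (n + 1))), E (a • y) = ε a • E y := fun a y => by
    refine (lid_rTensor_tensorAct (V := H) (ε := ε) he.1 (ρ a) y).trans ?_
    rw [hρ, smul_one_mul]
    rfl
  have hE' : ∀ y, E (dY (n + 1) y) = 0 := fun (y : Q.P (n + 2) ⊗[k] H) => by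
    change TensorProduct.lid k H (LinearMap.rTensor H e (LinearMap.rTensor H _ y)) = 0
    rw [← LinearMap.rTensor_comp_apply,
      show e ∘ₗ (Q.diff (n + 1)).restrictScalars k = 0 from LinearMap.ext he.2]
    simp
  let b : P.P n →ₗ[k] H :=
    { toFun := fun p => E (t p)
      map_add' := fun p q => by
        rw [map_add]
        exact map_add E _ _
      map_smul' := fun c p => by
        rw [← algebraMap_smul A c p, map_smul, hE, AlgHom.commutes]
        rfl }
  -- The homotopy term `E ∘ t` is an `H`-valued cochain on `P n`, so minimality kills its
  -- coboundary. This is why minimality is formulated for arbitrary coefficient spaces and not only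
  -- for `k`.
  have hb : b (P.diff n x) = 0 := hP H n b (fun a p => by
    change E (t (a • p)) = ε a • E (t p)
    rw [map_smul, hE]) x
  have h : E (g (n + 1) x) = 0 := by
    rw [ht]
    refine (map_add E _ _).trans ?_
    rw [hE', zero_add]
    exact hb
  have h' : E (cQ.coact (n + 1) (f (n + 1) x)) =
      E (LinearMap.rTensor H ((f (n + 1)).restrictScalars k) (cP.coact (n + 1) x)) :=
    sub_eq_zero.mp ((map_sub E _ _).symm.trans h)
  rw [LinearMap.rTensor_comp]
  exact h'

end Twisted

end Comparison

/-! ### Consequences of finite projective dimension and of `Ext(k, A)` for minimal resolutions. -/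

section Ext

open CategoryTheory

variable {k : Type u} [Field k] {A : Type u} [Ring A] [Algebra k A] {ε : A →ₐ[k] k}

namespace ProjResolution

variable (P : ProjResolution ε)

instance projective_of (i : ℕ) : Projective (ModuleCat.of A (P.P i)) :=
  (IsProjective.iff_projective _).mp (P.projective i)

/-- The short complex `0 → im d_i → P_i → X → 0` for a map `g` whose kernel is `im d_i`. -/
noncomputable abbrev syzygyComplex {i : ℕ} {X : ModuleCat.{u} A} (g : P.P i →ₗ[A] X)
    (hg : Function.Exact (P.diff i) g) : ShortComplex (ModuleCat.{u} A) where
  X₁ := ModuleCat.of A (LinearMap.range (P.diff i))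
  X₂ := ModuleCat.of A (P.P i)
  X₃ := X
  f := ModuleCat.ofHom (LinearMap.range (P.diff i)).subtype
  g := ModuleCat.ofHom g
  zero := by
    ext ⟨_, x, rfl⟩
    exact hg.apply_apply_eq_zero x

theorem syzygyComplex_shortExact {i : ℕ} {X : ModuleCat.{u} A} (g : P.P i →ₗ[A] X)
    (hg : Function.Exact (P.diff i) g) (hg' : Function.Surjective g) :
    (P.syzygyComplex g hg).ShortExact := by
  refine ModuleCat.shortComplex_shortExact _ (fun x => ?_) Subtype.val_injective hg'
  refine (hg x).trans ?_
  constructor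
  · rintro ⟨y, rfl⟩
    exact ⟨⟨_, y, rfl⟩, rfl⟩
  · rintro ⟨⟨_, y, rfl⟩, rfl⟩
    exact ⟨y, rfl⟩

/-- The augmentation as a map of `A`-modules to the trivial module. -/
def augHom : P.P 0 →ₗ[A] trivialModule ε where
  toFun := P.aug
  map_add' := map_add _
  map_smul' := P.aug_smul

theorem augComplex_shortExact :
    (P.syzygyComplex (X := trivialModule ε) P.augHom P.exact_zero).ShortExact :=
  P.syzygyComplex_shortExact _ P.exact_zero P.aug_surjective

theorem exact_rangeRestrict (i : ℕ) :
    Function.Exact (P.diff (i + 1)) (P.diff i).rangeRestrict := fun x => by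
  rw [← P.exact_succ i x, ← Subtype.val_inj]
  rfl

theorem diffComplex_shortExact (i : ℕ) :
    (P.syzygyComplex (X := ModuleCat.of A (LinearMap.range (P.diff i)))
      (P.diff i).rangeRestrict (P.exact_rangeRestrict i)).ShortExact :=
  P.syzygyComplex_shortExact _ (P.exact_rangeRestrict i) (P.diff i).surjective_rangeRestrict

/-- Each syzygy lowers the bound on the projective dimension by one; after `n + 1` of them, the
bound says projective. -/
theorem projective_range_diff {n : ℕ} (h : HasProjectiveDimensionLT (trivialModule ε) (n + 2)) :
    Module.Projective A (LinearMap.range (P.diff n)) := by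
  have key : ∀ i j, i + j = n →
      HasProjectiveDimensionLT (ModuleCat.of A (LinearMap.range (P.diff i))) (j + 1) := by
    intro i
    induction i with
    | zero =>
      rintro j rfl
      rw [zero_add] at h
      exact P.augComplex_shortExact.hasProjectiveDimensionLT_X₁ (j + 1)
        (inferInstanceAs (HasProjectiveDimensionLT (ModuleCat.of A (P.P 0)) (j + 1))) h
    | succ i ih =>
      intro j hj
      exact (P.diffComplex_shortExact i).hasProjectiveDimensionLT_X₁ (j + 1)
        (inferInstanceAs (HasProjectiveDimensionLT (ModuleCat.of A (P.P (i + 1))) (j + 1)))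
        (ih (j + 1) (by omega))
  have := key n 0 rfl
  rw [zero_add, ← projective_iff_hasProjectiveDimensionLT_one,
    ← IsProjective.iff_projective] at this
  exact this

/-- The cochains of a minimal resolution vanish beyond the projective dimension. -/
theorem IsMinimal.cochain_eq_zero {P : ProjResolution ε} (hP : P.IsMinimal) {n : ℕ}
    (h : HasProjectiveDimensionLT (trivialModule ε) (n + 2)) {g : P.P (n + 2) →ₗ[k] k}
    (hg : P.IsCochain g) : g = 0 := by
  have := P.projective_range_diff h
  -- The image of `d_n` is projective, so `P (n + 1)` splits and `π` is a projection onto `ker d_n =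
  -- im d_{n+1}`.
  obtain ⟨σ, hσ⟩ := Module.projective_lifting_property (P.diff n).rangeRestrict LinearMap.id
    (P.diff n).surjective_rangeRestrict
  let π : P.P (n + 1) →ₗ[A] P.P (n + 1) := LinearMap.id - σ ∘ₗ (P.diff n).rangeRestrict
  have hπ : ∀ p, π p ∈ LinearMap.range (P.diff (n + 1)) := fun p => by
    refine (P.exact_rangeRestrict n _).mp ?_
    have := LinearMap.congr_fun hσ ((P.diff n).rangeRestrict p)
    rw [LinearMap.sub_apply, map_sub, sub_eq_zero]
    exact this.symm
  have hker : ∀ x y, P.diff (n + 1) x = P.diff (n + 1) y → g x = g y := fun x y hxy => by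
    obtain ⟨z, hz⟩ := (P.exact_succ (n + 1) (x - y)).mp (by rw [map_sub, hxy, sub_self])
    rw [← sub_eq_zero, ← map_sub, ← hz]
    exact hP k _ g hg z
  -- The chosen preimages of `π p` under `d_{n+1}` need not be linear in `p`, but by `hker` their
  -- values under `g` do not depend on the choice. So `G = g ∘ lft` is a cochain whose coboundary is
  -- `g`, and minimality gives `g = 0`.
  choose lft hlft using hπ
  let G : P.P (n + 1) →ₗ[k] k :=
    { toFun := fun p => g (lft p)
      map_add' := fun p q => by
        rw [← map_add]
        exact hker _ _ (by simp only [map_add, hlft])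
      map_smul' := fun c p => by
        rw [RingHom.id_apply, ← map_smul]
        refine hker _ _ ?_
        rw [← algebraMap_smul A c p, ← algebraMap_smul A c (lft p), map_smul, hlft, hlft,
          map_smul] }
  have hG : P.IsCochain G := fun a p => by
    change g (lft (a • p)) = ε a • g (lft p)
    rw [← hg]
    refine hker _ _ ?_
    rw [map_smul, hlft, hlft, map_smul]
  ext x
  have h₁ : g (lft (P.diff (n + 1) x)) = 0 := hP k _ G hG x
  rw [LinearMap.zero_apply, ← h₁]
  refine hker _ _ ?_
  rw [hlft]
  have : (P.diff n).rangeRestrict (P.diff (n + 1) x) = 0 :=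
    (P.exact_rangeRestrict n).apply_apply_eq_zero x
  simp [π, this]

/-- Dimension shifting: there is a class `η ∈ Ext^{n + 1}(k, im d_n)` such that the maps from
`im d_n` annihilated by `η` extend to `P_n`. -/
theorem exists_ext_class (n : ℕ) :
    ∃ η : Abelian.Ext (trivialModule ε) (ModuleCat.of A (LinearMap.range (P.diff n))) (n + 1),
      ∀ (Y : ModuleCat.{u} A) (i j : ℕ) (hij : n + 1 + i = j)
        (x : Abelian.Ext (ModuleCat.of A (LinearMap.range (P.diff n))) Y i),
        η.comp x hij = 0 → ∃ y : Abelian.Ext (ModuleCat.of A (P.P n)) Y i,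
          (Abelian.Ext.mk₀ (ModuleCat.ofHom (LinearMap.range (P.diff n)).subtype)).comp y
            (zero_add i) = x := by
  induction n with
  | zero =>
    refine ⟨P.augComplex_shortExact.extClass, fun Y i j hij x hx => ?_⟩
    exact Abelian.Ext.contravariant_sequence_exact₁ P.augComplex_shortExact Y x _ hx
  | succ n ih =>
    obtain ⟨η, hη⟩ := ih
    have hS := P.diffComplex_shortExact n
    refine ⟨η.comp hS.extClass rfl, fun Y i j hij x hx => ?_⟩
    -- By induction this class comes from `Ext^{i+1}` of the projective module `P n`, which
    -- vanishes.
    have h₁ : hS.extClass.comp x (add_comm 1 i) = 0 := by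
      rw [Abelian.Ext.comp_assoc (a₂₃ := i + 1) η hS.extClass x rfl (add_comm 1 i)
        (by omega)] at hx
      obtain ⟨y, hy⟩ := hη Y (i + 1) j (by omega) _ hx
      rw [← hy, Abelian.Ext.eq_zero_of_projective y, Abelian.Ext.comp_zero]
    exact Abelian.Ext.contravariant_sequence_exact₁ hS Y x _ h₁

/-- If the minimal resolution has length `n + 1` and `U` is a space of `A`-linear forms on its last
term that are determined by their reductions modulo the augmentation ideal, then `U` embeds into
`Ext^{n + 1}(k, A)`. -/
theorem IsMinimal.exists_injective_ext {P : ProjResolution ε} (hP : P.IsMinimal) {n : ℕ}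
    (hn : Function.Injective (P.diff n)) {U : Type u} [AddCommGroup U] [Module k U]
    (l : U →+ (P.P (n + 1) →ₗ[A] A)) (hl : ∀ (c : k) x p, l (c • x) p = c • l x p)
    (hl' : ∀ x, (∀ p, ε (l x p) = 0) → x = 0) :
    ∃ θ : U →ₗ[k] Abelian.Ext (trivialModule ε) (ModuleCat.of A A) (n + 1),
      Function.Injective θ := by
  obtain ⟨η, hη⟩ := P.exists_ext_class n
  let e := LinearEquiv.ofInjective (P.diff n) hn
  let φ : U →+ (ModuleCat.of A (LinearMap.range (P.diff n)) ⟶ ModuleCat.of A A) :=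
    { toFun := fun x => ModuleCat.ofHom (l x ∘ₗ e.symm.toLinearMap)
      map_zero' := by
        ext p
        simp
      map_add' := fun x y => by
        ext p
        simp }
  let θ : U →ₗ[k] Abelian.Ext (trivialModule ε) (ModuleCat.of A A) (n + 1) :=
    { toFun := fun x => η.comp (Abelian.Ext.mk₀ (φ x)) (add_zero _)
      map_add' := fun x y => by
        rw [map_add, Abelian.Ext.mk₀_add, Abelian.Ext.comp_add]
      map_smul' := fun c x => by
        rw [RingHom.id_apply, ← Abelian.Ext.comp_smul, ← Abelian.Ext.mk₀_smul]
        congr 2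
        ext p
        refine (hl c x _).trans ?_
        rw [Algebra.smul_def]
        rfl }
  refine ⟨θ, (injective_iff_map_eq_zero θ).mpr fun x hx => hl' x fun p => ?_⟩
  -- If the class of `x` vanishes, the form `l x` factors as `f ∘ d_n` with `f : P n → A`. Then `ε ∘
  -- f` is a cochain, and minimality makes its coboundary `ε ∘ l x` zero.
  obtain ⟨y, hy⟩ := hη _ 0 _ (add_zero _) _ hx
  obtain ⟨f, rfl⟩ := (Abelian.Ext.mk₀_bijective _ _).2 y
  rw [Abelian.Ext.mk₀_comp_mk₀] at hy
  have hf := (Abelian.Ext.mk₀_bijective _ _).1 hy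
  have hlf : l x p = f.hom (P.diff n p) := by
    have := congrArg (fun g => g.hom (e p)) hf
    refine Eq.trans ?_ this.symm
    change l x p = l x (e.symm (e p))
    rw [e.symm_apply_apply]
  let f' : P.P n →ₗ[A] A := f.hom
  let b : P.P n →ₗ[k] k := ε.toLinearMap ∘ₗ f'.restrictScalars k
  have hb : P.IsCochain b := fun a q => by
    simp [b]
  rw [hlf]
  exact hP k n b hb p

end ProjResolution

end Ext

/-! ### Tensor powers, relations and superpotentials inside `T Z`. -/

section TensorAlgebra

variable {k Z : Type u} [Field k] [AddCommGroup Z] [Module k Z]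

theorem toTensorAlgebra_mulEquiv {p j : ℕ} (x : ⨂[k]^p Z) (y : ⨂[k]^j Z) :
    TensorPower.toTensorAlgebra (TensorPower.mulEquiv (R := k) (M := Z) (x ⊗ₜ[k] y)) =
      TensorPower.toTensorAlgebra x * TensorPower.toTensorAlgebra y :=
  TensorPower.toTensorAlgebra_gMul x y

theorem toTensorAlgebra_injective (j : ℕ) :
    Function.Injective (TensorPower.toTensorAlgebra : (⨂[k]^j Z) →ₗ[k] TensorAlgebra k Z) := by
  classical
  intro x y hxy
  have h : ∀ x : ⨂[k]^j Z, TensorAlgebra.ofDirectSum (DirectSum.of (fun n => ⨂[k]^n Z) j x) =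
      TensorPower.toTensorAlgebra x := fun x => DirectSum.toAddMonoid_of _ _ _
  rw [← h, ← h] at hxy
  exact DirectSum.of_injective j (TensorAlgebra.equivDirectSum.symm.injective hxy)

theorem range_toTensorAlgebra (j : ℕ) :
    LinearMap.range (TensorPower.toTensorAlgebra : (⨂[k]^j Z) →ₗ[k] TensorAlgebra k Z) =
      tensorPiece k Z j := by
  apply le_antisymm
  · rintro _ ⟨x, rfl⟩
    induction x using PiTensorProduct.induction_on with
    | add x y hx hy => rw [map_add]; exact add_mem hx hy
    | smul_tprod c z =>
      rw [map_smul, TensorPower.toTensorAlgebra_tprod, TensorAlgebra.tprod_apply]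
      refine Submodule.smul_mem _ c ?_
      clear c
      induction j with
      | zero =>
        rw [tensorPiece, pow_zero, List.ofFn_zero]
        exact Submodule.one_le.mp le_rfl
      | succ j ih =>
        rw [tensorPiece, pow_succ', List.ofFn_succ, List.prod_cons]
        exact Submodule.mul_mem_mul ⟨_, rfl⟩ (ih _)
  · induction j with
    | zero =>
      rw [tensorPiece, pow_zero, Submodule.one_le]
      exact ⟨PiTensorProduct.tprod k Fin.elim0, by
        rw [TensorPower.toTensorAlgebra_tprod, TensorAlgebra.tprod_apply, List.ofFn_zero]
        rfl⟩
    | succ j ih =>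
      rw [tensorPiece, pow_succ, Submodule.mul_le]
      rintro x hx _ ⟨z, rfl⟩
      obtain ⟨x, rfl⟩ := ih hx
      refine ⟨TensorPower.mulEquiv (x ⊗ₜ PiTensorProduct.tprod k fun _ : Fin 1 => z), ?_⟩
      rw [toTensorAlgebra_mulEquiv, TensorPower.toTensorAlgebra_tprod, TensorAlgebra.tprod_apply,
        List.ofFn_succ, List.ofFn_zero, List.prod_cons, List.prod_nil, mul_one]

theorem toTensorAlgebra_mem {j : ℕ} (x : ⨂[k]^j Z) :
    TensorPower.toTensorAlgebra x ∈ tensorPiece k Z j :=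
  range_toTensorAlgebra (k := k) (Z := Z) j ▸ ⟨x, rfl⟩

theorem exists_toTensorAlgebra_eq {j : ℕ} {t : TensorAlgebra k Z} (ht : t ∈ tensorPiece k Z j) :
    ∃ x : ⨂[k]^j Z, TensorPower.toTensorAlgebra x = t := by
  rwa [← range_toTensorAlgebra] at ht

theorem tensorPiece_mul (i j : ℕ) :
    tensorPiece k Z i * tensorPiece k Z j = tensorPiece k Z (i + j) :=
  (pow_add _ i j).symm

theorem relationSpace_le (N r : ℕ) (s : ⨂[k]^(N + r) Z) :
    relationSpace N r s ≤ tensorPiece k Z N := by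
  rintro _ ⟨x, -, rfl⟩
  exact toTensorAlgebra_mem x

theorem mul_relationSpace_mul_le (N r : ℕ) (s : ⨂[k]^(N + r) Z) (a b : ℕ) :
    tensorPiece k Z a * relationSpace N r s * tensorPiece k Z b ≤ tensorPiece k Z (a + N + b) := by
  rw [← tensorPiece_mul, ← tensorPiece_mul]
  exact mul_le_mul' (mul_le_mul' le_rfl (relationSpace_le N r s)) le_rfl

theorem mem_koszulSpace {N r : ℕ} {s : ⨂[k]^(N + r) Z} {j : ℕ} {x : ⨂[k]^j Z} :
    x ∈ koszulSpace N r s j ↔ ∀ a b : ℕ, a + N + b = j → TensorPower.toTensorAlgebra x ∈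
      tensorPiece k Z a * relationSpace N r s * tensorPiece k Z b := by
  simp [koszulSpace, Submodule.mem_iInf]

/-! ### The kernel of the projection to the superpotential algebra -/

theorem quotientMap_relation {N r : ℕ} {s : ⨂[k]^(N + r) Z} {x : TensorAlgebra k Z}
    (hx : x ∈ relationSpace N r s) : quotientMap N r s x = 0 :=
  (RingQuot.mkAlgHom_rel k ⟨hx, rfl⟩).trans (map_zero _)

theorem quotientMap_surjective (N r : ℕ) (s : ⨂[k]^(N + r) Z) :
    Function.Surjective (quotientMap N r s) :=
  RingQuot.mkAlgHom_surjective k _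

/-- The subspace `T R T` is stable under multiplication from both sides, so it contains the
difference of any two elements identified by the ring congruence that the relations generate. -/
theorem mem_of_quotientMap_eq_zero {N r : ℕ} {s : ⨂[k]^(N + r) Z} {x : TensorAlgebra k Z}
    (hx : quotientMap N r s x = 0) : x ∈ ⊤ * relationSpace N r s * ⊤ := by
  set I : Submodule k (TensorAlgebra k Z) := ⊤ * relationSpace N r s * ⊤ with hI
  have hmul : ∀ a x b : TensorAlgebra k Z, x ∈ I → a * x * b ∈ I := fun a x b hx => by
    have h : a * x * b ∈ ⊤ * I * (⊤ : Submodule k (TensorAlgebra k Z)) :=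
      Submodule.mul_mem_mul (Submodule.mul_mem_mul Submodule.mem_top hx) Submodule.mem_top
    refine (?_ : ⊤ * I * ⊤ ≤ I) h
    calc ⊤ * (⊤ * relationSpace N r s * ⊤) * (⊤ : Submodule k (TensorAlgebra k Z))
        = ⊤ * ⊤ * relationSpace N r s * (⊤ * ⊤) := by simp only [mul_assoc]
      _ ≤ _ := mul_le_mul' (mul_le_mul' le_top le_rfl) le_top
  have key : ∀ x y, RingQuot.Rel (fun x y : TensorAlgebra k Z =>
      x ∈ relationSpace N r s ∧ y = 0) x y → x - y ∈ I := by
    intro x y h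
    induction h with
    | @of x y h =>
      obtain ⟨h, rfl⟩ := h
      rw [sub_zero, ← one_mul x, ← mul_one (1 * x)]
      exact Submodule.mul_mem_mul (Submodule.mul_mem_mul Submodule.mem_top h) Submodule.mem_top
    | add_left _ ih => rwa [add_sub_add_right_eq_sub]
    | mul_left _ ih =>
      rw [← sub_mul, ← one_mul (_ - _)]
      exact hmul _ _ _ ih
    | mul_right _ ih =>
      rw [← mul_sub, ← mul_one (_ * _)]
      exact hmul _ _ _ ih
  have h : RingQuot.mkRingHom (fun x y : TensorAlgebra k Z => x ∈ relationSpace N r s ∧ y = 0) x =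
      RingQuot.mkRingHom (fun x y : TensorAlgebra k Z => x ∈ relationSpace N r s ∧ y = 0) 0 := by
    rw [← RingQuot.mkAlgHom_coe k]
    exact hx.trans (map_zero _).symm
  rw [RingQuot.mkRingHom_def] at h
  have h' := Quot.eqvGen_exact (congrArg RingQuot.toQuot h)
  have key' : ∀ x y, Relation.EqvGen (RingQuot.Rel fun x y : TensorAlgebra k Z =>
      x ∈ relationSpace N r s ∧ y = 0) x y → x - y ∈ I := by
    intro x y h
    induction h with
    | rel x y h => exact key x y h
    | refl x => rw [sub_self]; exact zero_mem _
    | symm x y _ ih => rw [← neg_sub]; exact neg_mem ih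
    | trans x y z _ _ ih ih' => rw [← sub_add_sub_cancel x y z]; exact add_mem ih ih'
  simpa using key' x 0 h'

/-- The degree `N` part of the ideal generated by the relations consists of the relations. -/
theorem mem_relationSpace_of_quotientMap_eq_zero {N r : ℕ} {s : ⨂[k]^(N + r) Z}
    {x : TensorAlgebra k Z} (hx : x ∈ tensorPiece k Z N) (hx' : quotientMap N r s x = 0) :
    x ∈ relationSpace N r s := by
  classical
  let 𝒜 : ℕ → Submodule k (TensorAlgebra k Z) := tensorPiece k Z
  let _ : GradedAlgebra 𝒜 := TensorAlgebra.gradedAlgebra (R := k) (M := Z)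
  let π : TensorAlgebra k Z →ₗ[k] TensorAlgebra k Z := GradedAlgebra.proj 𝒜 N
  have hπ : ∀ j, ∀ y ∈ 𝒜 j, π y = if j = N then y else 0 := fun j y hy => by
    rw [GradedAlgebra.proj_apply]
    split_ifs with h
    · subst h
      exact DirectSum.decompose_of_mem_same 𝒜 hy
    · exact DirectSum.decompose_of_mem_ne 𝒜 hy h
  have key : ∀ y ∈ ⊤ * relationSpace N r s * ⊤, π y ∈ relationSpace N r s := by
    intro y hy
    refine (?_ : ⊤ * relationSpace N r s * ⊤ ≤ (relationSpace N r s).comap π) hy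
    rw [mul_assoc, Submodule.mul_le]
    rintro a - y hy
    refine (?_ : relationSpace N r s * ⊤ ≤ (relationSpace N r s).comap
      (π ∘ₗ LinearMap.mulLeft k a)) hy
    rw [Submodule.mul_le]
    rintro x hx b -
    change π (a * (x * b)) ∈ relationSpace N r s
    induction a using DirectSum.Decomposition.inductionOn 𝒜 with
    | zero => simp
    | add a a' h h' => rw [add_mul, map_add]; exact add_mem h h'
    | @homogeneous i a =>
      induction b using DirectSum.Decomposition.inductionOn 𝒜 with
      | zero => simp
      | add b b' h h' => rw [mul_add, mul_add, map_add]; exact add_mem h h'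
      | @homogeneous j b =>
        have hmem : (a : TensorAlgebra k Z) * (x * b) ∈ 𝒜 (i + (N + j)) :=
          SetLike.mul_mem_graded a.2 (SetLike.mul_mem_graded (relationSpace_le N r s hx) b.2)
        rw [hπ _ _ hmem]
        split_ifs with h
        -- The product `a x b` has degree `i + N + j`, so it contributes to degree `N` only when `a`
        -- and `b` are scalars.
        · obtain rfl : i = 0 := by omega
          obtain rfl : j = 0 := by omega
          obtain ⟨c, hc⟩ := Submodule.mem_one.mp (show (a : TensorAlgebra k Z) ∈ 1 from a.2)
          obtain ⟨c', hc'⟩ := Submodule.mem_one.mp (show (b : TensorAlgebra k Z) ∈ 1 from b.2)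
          rw [← hc, ← hc', ← Algebra.commutes c', ← Algebra.smul_def, ← Algebra.smul_def]
          exact Submodule.smul_mem _ _ (Submodule.smul_mem _ _ hx)
        · exact zero_mem _
  have := key x (mem_of_quotientMap_eq_zero hx')
  rwa [hπ N x hx, if_pos rfl] at this

/-! ### Superpotentials and the Koszul spaces -/

theorem toTensorAlgebra_cyclicShift {m : ℕ} (v : ⨂[k]^m Z) (z : Z) :
    TensorPower.toTensorAlgebra (cyclicShift (m + 1)
      (TensorPower.mulEquiv (v ⊗ₜ PiTensorProduct.tprod k fun _ : Fin 1 => z))) =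
      TensorAlgebra.ι k z * TensorPower.toTensorAlgebra v := by
  induction v using PiTensorProduct.induction_on with
  | add v v' h h' => rw [TensorProduct.add_tmul, map_add, map_add, map_add, map_add, mul_add, h, h']
  | smul_tprod c w =>
    rw [← TensorProduct.smul_tmul', map_smul, map_smul, map_smul, map_smul, mul_smul_comm]
    congr 1
    have h : TensorPower.mulEquiv (R := k) (M := Z)
        (PiTensorProduct.tprod k w ⊗ₜ PiTensorProduct.tprod k fun _ : Fin 1 => z) =
        PiTensorProduct.tprod k (Fin.append w fun _ : Fin 1 => z) :=
      TensorPower.tprod_mul_tprod k w _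
    rw [h, cyclicShift, LinearEquiv.coe_coe, PiTensorProduct.reindex_tprod,
      TensorPower.toTensorAlgebra_tprod, TensorPower.toTensorAlgebra_tprod,
      TensorAlgebra.tprod_apply, TensorAlgebra.tprod_apply, List.ofFn_succ, List.prod_cons]
    congr 2
    · rw [show (finRotate (m + 1)).symm 0 = Fin.last m by
        rw [Equiv.symm_apply_eq, finRotate_last]]
      exact Fin.append_right w _ (0 : Fin 1)
    · congr 1
      funext i
      congr 1
      rw [show (finRotate (m + 1)).symm i.succ = i.castSucc by
        rw [Equiv.symm_apply_eq, finRotate_apply, Fin.coeSucc_eq_succ]]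
      exact Fin.append_left w _ i

theorem toTensorAlgebra_mapFirst {m : ℕ} (φ : Z →ₗ[k] Z) (v : ⨂[k]^m Z) (z : Z) :
    ∃ y : ⨂[k]^(m + 1) Z,
      TensorPower.toTensorAlgebra y = TensorAlgebra.ι k z * TensorPower.toTensorAlgebra v ∧
      TensorPower.toTensorAlgebra (mapFirst (m + 1) φ y) =
        TensorAlgebra.ι k (φ z) * TensorPower.toTensorAlgebra v := by
  induction v using PiTensorProduct.induction_on with
  | add v v' h h' =>
    obtain ⟨y, hy, hy'⟩ := h
    obtain ⟨x, hx, hx'⟩ := h'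
    exact ⟨y + x, by simp only [map_add, mul_add, hy, hx], by
      simp only [map_add, mul_add, hy', hx']⟩
  | smul_tprod c w =>
    refine ⟨c • PiTensorProduct.tprod k (Fin.cons z w : Fin (m + 1) → Z), ?_, ?_⟩
    · rw [map_smul, map_smul, mul_smul_comm, TensorPower.toTensorAlgebra_tprod,
        TensorPower.toTensorAlgebra_tprod, TensorAlgebra.tprod_apply, TensorAlgebra.tprod_apply,
        List.ofFn_succ, List.prod_cons]
      simp
    · rw [map_smul, map_smul, map_smul, mul_smul_comm, mapFirst, PiTensorProduct.map_tprod,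
        TensorPower.toTensorAlgebra_tprod, TensorPower.toTensorAlgebra_tprod,
        TensorAlgebra.tprod_apply, TensorAlgebra.tprod_apply, List.ofFn_succ, List.prod_cons]
      simp

theorem mapFirst_injective (m : ℕ) (φ : Z ≃ₗ[k] Z) :
    Function.Injective (mapFirst (k := k) m φ.toLinearMap) := by
  refine Function.LeftInverse.injective (g := mapFirst m φ.symm.toLinearMap) fun x => ?_
  rw [mapFirst, mapFirst, ← LinearMap.comp_apply, ← PiTensorProduct.map_comp]
  convert LinearMap.id_apply (R := k) x
  rw [← PiTensorProduct.map_id]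
  congr 1
  funext i
  split_ifs <;> ext <;> simp

/-- If a twisted superpotential lies in `Z ⊗ V`, then it lies in `V ⊗ Z`. -/
theorem IsTwistedSuperpotential.mem_mul {M m : ℕ} (hM : M = m + 1) {s : ⨂[k]^M Z}
    (hs : IsTwistedSuperpotential s) {V : Submodule k (TensorAlgebra k Z)}
    (hV : V ≤ tensorPiece k Z m)
    (h : TensorPower.toTensorAlgebra s ∈ LinearMap.range (TensorAlgebra.ι k) * V) :
    TensorPower.toTensorAlgebra s ∈ V * LinearMap.range (TensorAlgebra.ι k) := by
  subst hM
  obtain ⟨φ, hφ⟩ := hs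
  -- Since `φ` is invertible, `φ ⊗ id` maps `Z ⊗ V` onto itself, and by `h₂` the cyclic shift maps
  -- `V ⊗ Z` onto `Z ⊗ V`. Both maps are injective, so undoing them on `(φ ⊗ id) (c s) = s` carries
  -- `s` from `Z ⊗ V` to `V ⊗ Z`.
  have h₁ : ∀ t ∈ LinearMap.range (TensorAlgebra.ι k) * V, ∃ y : ⨂[k]^(m + 1) Z,
      TensorPower.toTensorAlgebra y ∈ LinearMap.range (TensorAlgebra.ι k) * V ∧
      TensorPower.toTensorAlgebra (mapFirst (m + 1) φ.toLinearMap y) = t := by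
    intro t ht
    induction ht using Submodule.mul_induction_on' with
    | mem_mul_mem z hz v hv =>
      obtain ⟨z, rfl⟩ := hz
      obtain ⟨v', rfl⟩ := exists_toTensorAlgebra_eq (hV hv)
      obtain ⟨y, hy, hy'⟩ := toTensorAlgebra_mapFirst φ.toLinearMap v' (φ.symm z)
      refine ⟨y, hy ▸ Submodule.mul_mem_mul ⟨_, rfl⟩ hv, ?_⟩
      simpa using hy'
    | add x _ y _ hx hy =>
      obtain ⟨x', h, rfl⟩ := hx
      obtain ⟨y', h', rfl⟩ := hy
      exact ⟨x' + y', by rw [map_add]; exact add_mem h h', by simp only [map_add]⟩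
  have h₂ : ∀ t ∈ LinearMap.range (TensorAlgebra.ι k) * V, ∃ y : ⨂[k]^(m + 1) Z,
      TensorPower.toTensorAlgebra y ∈ V * LinearMap.range (TensorAlgebra.ι k) ∧
      TensorPower.toTensorAlgebra (cyclicShift (m + 1) y) = t := by
    intro t ht
    induction ht using Submodule.mul_induction_on' with
    | mem_mul_mem z hz v hv =>
      obtain ⟨z, rfl⟩ := hz
      obtain ⟨v', rfl⟩ := exists_toTensorAlgebra_eq (hV hv)
      refine ⟨_, ?_, toTensorAlgebra_cyclicShift v' z⟩
      rw [toTensorAlgebra_mulEquiv]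
      refine Submodule.mul_mem_mul hv ⟨z, ?_⟩
      simp [TensorPower.toTensorAlgebra_tprod, TensorAlgebra.tprod_apply]
    | add x _ y _ hx hy =>
      obtain ⟨x', h, rfl⟩ := hx
      obtain ⟨y', h', rfl⟩ := hy
      exact ⟨x' + y', by rw [map_add]; exact add_mem h h', by simp only [map_add]⟩
  obtain ⟨y, hy, hys⟩ := h₁ _ h
  have hy' : cyclicShift (m + 1) s = y :=
    mapFirst_injective (m + 1) φ (hφ.trans (toTensorAlgebra_injective _ hys).symm)
  obtain ⟨x, hx, hxy⟩ := h₂ _ hy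
  have : x = s := (PiTensorProduct.reindex k (fun _ : Fin (m + 1) => Z)
    (finRotate (m + 1))).injective ((toTensorAlgebra_injective _ hxy).trans hy'.symm)
  exact this ▸ hx

theorem contractFirst_tprod {m : ℕ} (ν : Module.Dual k Z) (z : Fin (m + 1) → Z) :
    contractFirst m ν (PiTensorProduct.tprod k z) =
      ν (z 0) • PiTensorProduct.tprod k (Fin.tail z) := by
  rw [contractFirst, PiTensorProduct.lift.tprod]
  rfl

/-- Expand the first tensor factor in a finite basis of `Z`: the coefficients are contractions by
the coordinate forms. -/
theorem map_toTensorAlgebra_le_mul_partialSpace [FiniteDimensional k Z] {m : ℕ}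
    (W : Submodule k (⨂[k]^(m + 1) Z)) :
    W.map TensorPower.toTensorAlgebra ≤
      LinearMap.range (TensorAlgebra.ι k) * (partialSpace W).map TensorPower.toTensorAlgebra := by
  rintro _ ⟨w, hw, rfl⟩
  let b := Module.finBasis k Z
  have h : ∀ w : ⨂[k]^(m + 1) Z, TensorPower.toTensorAlgebra w = ∑ i, TensorAlgebra.ι k (b i) *
      TensorPower.toTensorAlgebra (contractFirst m (b.coord i) w) := by
    intro w
    induction w using PiTensorProduct.induction_on with
    | add w w' h h' => simp only [map_add, mul_add, Finset.sum_add_distrib, ← h, ← h']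
    | smul_tprod c z =>
      simp only [map_smul, mul_smul_comm, ← Finset.smul_sum, contractFirst_tprod]
      congr 1
      simp only [← smul_mul_assoc, ← map_smul, ← Finset.sum_mul, ← map_sum]
      have hb : ∑ i, b.coord i (z 0) • b i = z 0 := b.sum_repr (z 0)
      rw [hb, TensorPower.toTensorAlgebra_tprod, TensorPower.toTensorAlgebra_tprod,
        TensorAlgebra.tprod_apply, TensorAlgebra.tprod_apply, List.ofFn_succ, List.prod_cons]
      rfl
  rw [h]
  refine sum_mem fun i _ => Submodule.mul_mem_mul ⟨_, rfl⟩ ⟨_, ?_, rfl⟩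
  exact Submodule.mem_iSup_of_mem (b.coord i) ⟨w, hw, rfl⟩

theorem map_toTensorAlgebra_le_mul_iterPartial [FiniteDimensional k Z] {N r : ℕ}
    (W : Submodule k (⨂[k]^(N + r) Z)) :
    W.map TensorPower.toTensorAlgebra ≤
      tensorPiece k Z r * (iterPartial N r W).map TensorPower.toTensorAlgebra := by
  induction r with
  | zero => rw [tensorPiece, pow_zero, one_mul]; exact le_rfl
  | succ r ih =>
    refine (map_toTensorAlgebra_le_mul_partialSpace W).trans ?_
    rw [tensorPiece, pow_succ', mul_assoc]
    exact mul_le_mul' le_rfl (ih (partialSpace W))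

/-- A twisted superpotential of degree `m` lies in the Koszul space of degree `m`. -/
theorem IsTwistedSuperpotential.mem_koszulSpace [FiniteDimensional k Z] {N r : ℕ}
    {s : ⨂[k]^(N + r) Z} (hs : IsTwistedSuperpotential s) : s ∈ koszulSpace N r s (N + r) := by
  rw [SuperpotentialHopf.mem_koszulSpace]
  intro a b hab
  obtain rfl : r = a + b := by omega
  -- The case `b' = 0` holds because `R` is obtained from `s` by contracting the first `r` factors.
  -- Each further step rotates one copy of `Z` from the left end to the right end by twisted cyclic
  -- invariance.
  have key : ∀ b' a', a' + b' = a + b → TensorPower.toTensorAlgebra s ∈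
      tensorPiece k Z a' * relationSpace N (a + b) s * tensorPiece k Z b' := by
    intro b'
    induction b' with
    | zero =>
      rintro a' rfl
      rw [tensorPiece, tensorPiece, pow_zero, mul_one]
      exact map_toTensorAlgebra_le_mul_iterPartial _
        ⟨s, Submodule.mem_span_singleton_self s, rfl⟩
    | succ b' ih =>
      intro a' h
      have h' := ih (a' + 1) (by omega)
      rw [tensorPiece, pow_succ', mul_assoc, mul_assoc, ← mul_assoc (_ ^ a')] at h'
      rw [tensorPiece, tensorPiece, pow_succ, ← mul_assoc]
      exact hs.mem_mul (m := a' + N + b') (by omega)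
        (mul_relationSpace_mul_le N (a + b) s a' b') h'
  exact key b a rfl

theorem relationSpace_zero (N r : ℕ) : relationSpace N r (0 : ⨂[k]^(N + r) Z) = ⊥ := by
  have h : ∀ r, iterPartial N r (⊥ : Submodule k (⨂[k]^(N + r) Z)) = ⊥ := by
    intro r
    induction r with
    | zero => rfl
    | succ r ih =>
      rw [iterPartial, show partialSpace (⊥ : Submodule k (⨂[k]^(N + r + 1) Z)) = ⊥ by
        simp [partialSpace]]
      exact ih
  rw [relationSpace, Submodule.span_zero_singleton, h, Submodule.map_bot]

/-- Used to exclude `s = 0`: then `R = 0`, and from degree `N` on at least one condition involving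
`R` is imposed. -/
theorem koszulSpace_zero (N r : ℕ) {j : ℕ} (hj : N ≤ j) :
    koszulSpace N r (0 : ⨂[k]^(N + r) Z) j = ⊥ := by
  rw [eq_bot_iff]
  intro x hx
  have := mem_koszulSpace.mp hx 0 (j - N) (by omega)
  rw [relationSpace_zero, Submodule.mul_bot, Submodule.bot_mul, Submodule.mem_bot] at this
  exact toTensorAlgebra_injective _ (this.trans (map_zero _).symm)

end TensorAlgebra

/-! ### Inclusions between Koszul spaces. -/

section KoszulSpaces

variable {k : Type u} [Field k]

theorem mem_range_lTensor_iff {M H : Type u} [AddCommGroup M] [Module k M]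
    [AddCommGroup H] [Module k H] (V : Submodule k M) (y : H ⊗[k] M) :
    y ∈ LinearMap.range (LinearMap.lTensor H V.subtype) ↔
      TensorProduct.comm k H M y ∈ LinearMap.range (LinearMap.rTensor H V.subtype) := by
  constructor
  · rintro ⟨x, rfl⟩
    exact ⟨TensorProduct.comm k H V x, LinearMap.rTensor_comm _ x⟩
  · rintro ⟨x, hx⟩
    refine ⟨TensorProduct.comm k V H x, (TensorProduct.comm k H M).injective ?_⟩
    rw [← hx]
    exact ((LinearMap.rTensor_comm V.subtype (TensorProduct.comm k V H x)).symm.trans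
      (by rw [TensorProduct.comm_comm]))

/-- After the flip, membership is tested on slices in `M`, where an intersection, even an infinite
one, is tested termwise. -/
theorem mem_range_lTensor_iInf {M H : Type u} [AddCommGroup M] [Module k M]
    [AddCommGroup H] [Module k H] {ι : Sort*} {V : ι → Submodule k M} {y : H ⊗[k] M}
    (h : ∀ i, y ∈ LinearMap.range (LinearMap.lTensor H (V i).subtype)) :
    y ∈ LinearMap.range (LinearMap.lTensor H (⨅ i, V i).subtype) := by
  simp only [mem_range_lTensor_iff, mem_range_rTensor_iff] at h ⊢
  exact fun φ => Submodule.mem_iInf _ |>.mpr fun i => h i φ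

variable {Z : Type u} [AddCommGroup Z] [Module k Z]

/-- The Koszul space of degree `p + j` is contained in `Z^{⊗ p} ⊗ W_j`. -/
theorem mulEquiv_symm_mem_of_mem_koszulSpace {N r : ℕ} {s : ⨂[k]^(N + r) Z} {p j : ℕ}
    {x : ⨂[k]^(p + j) Z} (hx : x ∈ koszulSpace N r s (p + j)) :
    (TensorPower.mulEquiv (R := k) (M := Z) (n := p) (m := j)).symm x ∈
      LinearMap.range (LinearMap.lTensor (⨂[k]^p Z) (koszulSpace N r s j).subtype) := by
  refine mem_range_lTensor_iInf fun a => mem_range_lTensor_iInf fun b =>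
    mem_range_lTensor_iInf fun hab => ?_
  -- The condition at position `(a, b)` in degree `j` is the condition at position `(p + a, b)` in
  -- degree `p + j`.
  have h := mem_koszulSpace.mp hx (p + a) b (by omega)
  rw [← tensorPiece_mul, mul_assoc, mul_assoc, ← mul_assoc (tensorPiece k Z a)] at h
  have key : ∀ t ∈ tensorPiece k Z p *
      (tensorPiece k Z a * relationSpace N r s * tensorPiece k Z b),
      ∃ y ∈ LinearMap.range (LinearMap.lTensor (⨂[k]^p Z)
        ((tensorPiece k Z a * relationSpace N r s * tensorPiece k Z b).comap
          (TensorPower.toTensorAlgebra : (⨂[k]^j Z) →ₗ[k] TensorAlgebra k Z)).subtype),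
        TensorPower.toTensorAlgebra (TensorPower.mulEquiv (R := k) (M := Z) y) = t := by
    intro t ht
    induction ht using Submodule.mul_induction_on' with
    | mem_mul_mem u hu v hv =>
      obtain ⟨u, rfl⟩ := exists_toTensorAlgebra_eq hu
      obtain ⟨v', rfl⟩ := exists_toTensorAlgebra_eq
        (hab ▸ mul_relationSpace_mul_le N r s a b hv : v ∈ tensorPiece k Z j)
      exact ⟨u ⊗ₜ v', ⟨u ⊗ₜ ⟨v', hv⟩, rfl⟩, toTensorAlgebra_mulEquiv u v'⟩
    | add x _ y _ hx hy =>
      obtain ⟨x', h, rfl⟩ := hx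
      obtain ⟨y', h', rfl⟩ := hy
      exact ⟨x' + y', add_mem h h', by simp only [map_add]⟩
  obtain ⟨y, hy, hyx⟩ := key _ h
  rwa [← toTensorAlgebra_injective _ hyx, LinearEquiv.symm_apply_apply]

end KoszulSpaces

/-! ### The Koszul resolution, its minimality and its last term. -/

section Koszul

variable {k Z : Type u} [Field k] [AddCommGroup Z] [Module k Z]

theorem algebraMapInv_eq_zero {p : ℕ} (hp : 0 < p) {t : TensorAlgebra k Z}
    (ht : t ∈ tensorPiece k Z p) : TensorAlgebra.algebraMapInv t = 0 := by
  obtain ⟨p, rfl⟩ : ∃ n, p = n + 1 := ⟨p - 1, by omega⟩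
  rw [tensorPiece, pow_succ] at ht
  induction ht using Submodule.mul_induction_on' with
  | mem_mul_mem x _ y hy =>
    obtain ⟨z, rfl⟩ := hy
    simp [TensorAlgebra.algebraMapInv]
  | add x _ y _ hx hy => rw [map_add, hx, hy, add_zero]

theorem koszulStep_pos {N : ℕ} (hN : 2 ≤ N) (i : ℕ) : 0 < koszulStep N i := by
  unfold koszulStep
  split_ifs <;> omega

/-- The inclusion `W_j → T Z`. -/
noncomputable def koszulIncl (N r : ℕ) (s : ⨂[k]^(N + r) Z) (j : ℕ) :
    koszulSpace N r s j →ₗ[k] TensorAlgebra k Z :=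
  TensorPower.toTensorAlgebra ∘ₗ (koszulSpace N r s j).subtype

theorem koszulIncl_injective (N r : ℕ) (s : ⨂[k]^(N + r) Z) (j : ℕ) :
    Function.Injective (koszulIncl N r s j) :=
  (toTensorAlgebra_injective j).comp Subtype.val_injective

theorem koszulIncl_mem {N r : ℕ} {s : ⨂[k]^(N + r) Z} {j : ℕ} (w : koszulSpace N r s j) :
    koszulIncl N r s j w ∈ tensorPiece k Z j :=
  toTensorAlgebra_mem _

theorem mem_range_koszulIncl {N r : ℕ} {s : ⨂[k]^(N + r) Z} {j : ℕ} {t : TensorAlgebra k Z} :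
    t ∈ LinearMap.range (koszulIncl N r s j) ↔ t ∈ tensorPiece k Z j ∧
      ∀ a b : ℕ, a + N + b = j →
        t ∈ tensorPiece k Z a * relationSpace N r s * tensorPiece k Z b := by
  constructor
  · rintro ⟨w, rfl⟩
    exact ⟨koszulIncl_mem w, mem_koszulSpace.mp w.2⟩
  · rintro ⟨ht, h⟩
    obtain ⟨x, rfl⟩ := exists_toTensorAlgebra_eq ht
    exact ⟨⟨x, mem_koszulSpace.mpr h⟩, rfl⟩

/-- Over a field `Z^{⊗ p} ⊗ W_j` embeds into `Z^{⊗ p} ⊗ Z^{⊗ j}`, so the inclusion of `W_{p+j}` into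
the latter factors through it linearly. -/
theorem exists_koszulSplit (N r : ℕ) (s : ⨂[k]^(N + r) Z) (p j : ℕ) :
    ∃ f : koszulSpace N r s (p + j) →ₗ[k] (⨂[k]^p Z) ⊗[k] koszulSpace N r s j,
      ∀ w, LinearMap.lTensor (⨂[k]^p Z) (koszulSpace N r s j).subtype (f w) =
        TensorPower.mulEquiv.symm (w : ⨂[k]^(p + j) Z) := by
  have hi : Function.Injective
      (LinearMap.lTensor (⨂[k]^p Z) (koszulSpace N r s j).subtype) :=
    Module.Flat.lTensor_preserves_injective_linearMap _ Subtype.val_injective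
  refine ⟨(LinearEquiv.ofInjective _ hi).symm.toLinearMap ∘ₗ
    (TensorPower.mulEquiv.symm.toLinearMap ∘ₗ
      (koszulSpace N r s (p + j)).subtype).codRestrict _
        (fun w => mulEquiv_symm_mem_of_mem_koszulSpace w.2), fun w => ?_⟩
  simp [← LinearEquiv.ofInjective_apply (h := hi)]

/-- The inclusion `W_{p + j} → Z^{⊗ p} ⊗ W_j`. -/
noncomputable def koszulSplit (N r : ℕ) (s : ⨂[k]^(N + r) Z) (p j : ℕ) :
    koszulSpace N r s (p + j) →ₗ[k] (⨂[k]^p Z) ⊗[k] koszulSpace N r s j :=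
  (exists_koszulSplit N r s p j).choose

theorem mulEquiv_koszulSplit {N r : ℕ} {s : ⨂[k]^(N + r) Z} {p j : ℕ}
    (w : koszulSpace N r s (p + j)) :
    TensorPower.mulEquiv (LinearMap.lTensor (⨂[k]^p Z) (koszulSpace N r s j).subtype
      (koszulSplit N r s p j w)) = (w : ⨂[k]^(p + j) Z) := by
  rw [koszulSplit, (exists_koszulSplit N r s p j).choose_spec, LinearEquiv.apply_symm_apply]

/-- The multiplication `Z^{⊗ p} ⊗ W_j → T Z`. -/
noncomputable def koszulMul (N r : ℕ) (s : ⨂[k]^(N + r) Z) (p j : ℕ) :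
    (⨂[k]^p Z) ⊗[k] koszulSpace N r s j →ₗ[k] TensorAlgebra k Z :=
  TensorPower.toTensorAlgebra ∘ₗ (TensorPower.mulEquiv (R := k) (M := Z)).toLinearMap ∘ₗ
    LinearMap.lTensor (⨂[k]^p Z) (koszulSpace N r s j).subtype

theorem koszulMul_tmul {N r : ℕ} {s : ⨂[k]^(N + r) Z} {p j : ℕ} (x : ⨂[k]^p Z)
    (w : koszulSpace N r s j) :
    koszulMul N r s p j (x ⊗ₜ w) = TensorPower.toTensorAlgebra x * koszulIncl N r s j w :=
  toTensorAlgebra_mulEquiv x (w : ⨂[k]^j Z)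

theorem koszulMul_injective (N r : ℕ) (s : ⨂[k]^(N + r) Z) (p j : ℕ) :
    Function.Injective (koszulMul N r s p j) :=
  (toTensorAlgebra_injective _).comp (TensorPower.mulEquiv.injective.comp
    (Module.Flat.lTensor_preserves_injective_linearMap _ Subtype.val_injective))

theorem koszulMul_koszulSplit {N r : ℕ} {s : ⨂[k]^(N + r) Z} {p j : ℕ}
    (w : koszulSpace N r s (p + j)) :
    koszulMul N r s p j (koszulSplit N r s p j w) = koszulIncl N r s (p + j) w :=
  congrArg _ (mulEquiv_koszulSplit w)

/-- The `A`-linear extension `a ⊗ w ↦ a • f w` of a linear map. -/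
noncomputable def freeLift {k A W M : Type u} [Field k] [Ring A] [Algebra k A] [AddCommGroup W]
    [Module k W] [AddCommGroup M] [Module k M] [Module A M] [IsScalarTower k A M] (f : W →ₗ[k] M) :
    A ⊗[k] W →ₗ[A] M where
  toFun := TensorProduct.lift ((Algebra.lsmul k k M).toLinearMap.compl₂ f)
  map_add' := map_add _
  map_smul' a x := by
    induction x with
    | zero => simp
    | add x y hx hy => simp only [smul_add, map_add, hx, hy]
    | tmul b w => simp [TensorProduct.smul_tmul']

theorem freeLift_tmul {k A W M : Type u} [Field k] [Ring A] [Algebra k A] [AddCommGroup W]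
    [Module k W] [AddCommGroup M] [Module k M] [Module A M] [IsScalarTower k A M] (f : W →ₗ[k] M)
    (a : A) (w : W) : freeLift f (a ⊗ₜ[k] w) = a • f w := rfl

variable {A : Type u} [Ring A] [Algebra k A] (q : TensorAlgebra k Z →ₐ[k] A)

/-- The restriction of the Koszul differential to `W_{p + j}`. -/
noncomputable def koszulSymbol (N r : ℕ) (s : ⨂[k]^(N + r) Z) (p j : ℕ) :
    koszulSpace N r s (p + j) →ₗ[k] A ⊗[k] koszulSpace N r s j :=
  LinearMap.rTensor (koszulSpace N r s j) (q.toLinearMap ∘ₗ TensorPower.toTensorAlgebra) ∘ₗ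
    koszulSplit N r s p j

/-- The Koszul differential `A ⊗ W_{p + j} → A ⊗ W_j`. -/
noncomputable def koszulMap (N r : ℕ) (s : ⨂[k]^(N + r) Z) (p j : ℕ) :
    A ⊗[k] koszulSpace N r s (p + j) →ₗ[A] A ⊗[k] koszulSpace N r s j :=
  freeLift (koszulSymbol q N r s p j)

variable {q} {N r : ℕ} {s : ⨂[k]^(N + r) Z}

theorem koszulMap_tmul {p j : ℕ} (a : A) (w : koszulSpace N r s (p + j)) :
    koszulMap q N r s p j (a ⊗ₜ w) = a • koszulSymbol q N r s p j w :=
  freeLift_tmul _ _ _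

variable {ε : A →ₐ[k] k}

variable (ε) in
/-- The augmentation `A ⊗ W_j → k` (for `j = 0`). -/
noncomputable def koszulAug (N r : ℕ) (s : ⨂[k]^(N + r) Z) (j : ℕ) :
    A ⊗[k] koszulSpace N r s j →ₗ[k] k :=
  (TensorProduct.lid k k).toLinearMap ∘ₗ TensorProduct.map ε.toLinearMap
    (TensorAlgebra.algebraMapInv.toLinearMap ∘ₗ koszulIncl N r s j)

theorem koszulAug_tmul {j : ℕ} (a : A) (w : koszulSpace N r s j) :
    koszulAug ε N r s j (a ⊗ₜ w) =
      ε a * TensorAlgebra.algebraMapInv (koszulIncl N r s j w) := by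
  simp [koszulAug]

theorem koszulAug_smul {j : ℕ} (a : A) (x : A ⊗[k] koszulSpace N r s j) :
    koszulAug ε N r s j (a • x) = ε a * koszulAug ε N r s j x := by
  induction x with
  | zero => simp
  | add x y hx hy => simp only [smul_add, map_add, hx, hy, mul_add]
  | tmul b w => rw [TensorProduct.smul_tmul', koszulAug_tmul, koszulAug_tmul, smul_eq_mul,
      map_mul, mul_assoc]

/-- Linear maps to trivial modules vanish on the image of the Koszul differential. -/
theorem cochain_koszulMap_eq_zero (hε : ∀ t, ε (q t) = TensorAlgebra.algebraMapInv t) {p j : ℕ}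
    (hp : 0 < p) {V : Type u} [AddCommGroup V] [Module k V]
    {b : A ⊗[k] koszulSpace N r s j →ₗ[k] V} (hb : ∀ a x, b (a • x) = ε a • b x)
    (x : A ⊗[k] koszulSpace N r s (p + j)) : b (koszulMap q N r s p j x) = 0 := by
  induction x with
  | zero => simp
  | add x y hx hy => simp only [map_add, hx, hy, add_zero]
  | tmul a w =>
    rw [koszulMap_tmul, hb, koszulSymbol, LinearMap.comp_apply]
    convert smul_zero _
    -- The `A`-components of the differential come from `Z^{⊗ p}` with `p > 0`, so `ε` annihilates
    -- them.
    generalize koszulSplit N r s p j w = ξ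
    induction ξ with
    | zero => simp
    | add x y hx hy => simp only [map_add, hx, hy, add_zero]
    | tmul x y =>
      have h := hb (q (TensorPower.toTensorAlgebra x)) (1 ⊗ₜ y)
      rw [hε, algebraMapInv_eq_zero hp (toTensorAlgebra_mem x), zero_smul,
        TensorProduct.smul_tmul', smul_eq_mul, mul_one] at h
      exact h

theorem exists_koszulIncl_eq_one (hN : 2 ≤ N) (s : ⨂[k]^(N + r) Z) :
    ∃ w : koszulSpace N r s (koszulDegree N 0), koszulIncl N r s _ w = 1 := by
  refine mem_range_koszulIncl.mpr ⟨?_, fun a b h => ?_⟩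
  · change 1 ∈ tensorPiece k Z 0
    rw [tensorPiece, pow_zero]
    exact Submodule.one_le.mp le_rfl
  · change a + N + b = 0 at h
    omega

theorem exists_koszulIncl_eq_algebraMap (w : koszulSpace N r s (koszulDegree N 0)) :
    ∃ c : k, koszulIncl N r s _ w = algebraMap k _ c := by
  have h : koszulIncl N r s _ w ∈ tensorPiece k Z 0 := koszulIncl_mem w
  rw [tensorPiece, pow_zero] at h
  obtain ⟨c, hc⟩ := Submodule.mem_one.mp h
  exact ⟨c, hc.symm⟩

/-- `W_0` is spanned by `1` and `W_1 = Z`, since `N ≥ 2` leaves no relations in these degrees. The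
first differential thus has image the part of positive degree, because every element of that degree
is a sum of products `u z` with `z ∈ Z`. -/
theorem koszulAug_exact (hN : 2 ≤ N) (s : ⨂[k]^(N + r) Z) (hq : Function.Surjective q)
    (hε : ∀ t, ε (q t) = TensorAlgebra.algebraMapInv t) :
    Function.Exact (koszulMap q N r s (koszulStep N 0) (koszulDegree N 0))
      (koszulAug ε N r s (koszulDegree N 0)) := by
  classical
  intro x
  refine ⟨fun hx => ?_, ?_⟩
  swap
  · rintro ⟨y, rfl⟩
    exact cochain_koszulMap_eq_zero hε (koszulStep_pos hN 0) koszulAug_smul y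
  obtain ⟨w₀, hw₀⟩ := exists_koszulIncl_eq_one hN s
  let D := (koszulMap q N r s (koszulStep N 0) (koszulDegree N 0)).restrictScalars k
  have key : ∀ t : TensorAlgebra k Z, (q t) ⊗ₜ[k] w₀ -
      (TensorAlgebra.algebraMapInv t : k) • (1 ⊗ₜ[k] w₀) ∈ LinearMap.range D := by
    intro t
    let 𝒜 : ℕ → Submodule k (TensorAlgebra k Z) := tensorPiece k Z
    let _ : GradedAlgebra 𝒜 := TensorAlgebra.gradedAlgebra (R := k) (M := Z)
    induction t using DirectSum.Decomposition.inductionOn 𝒜 with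
    | zero => simp
    | add t t' h h' =>
      rw [map_add, map_add, TensorProduct.add_tmul, add_smul, add_sub_add_comm]
      exact add_mem h h'
    | @homogeneous i t =>
      obtain ⟨t, ht⟩ := t
      change (q t) ⊗ₜ[k] w₀ - (TensorAlgebra.algebraMapInv t : k) • _ ∈ _
      cases i with
      | zero =>
        obtain ⟨c, rfl⟩ := Submodule.mem_one.mp (show t ∈ 1 from ht)
        rw [AlgHom.commutes, AlgHom.commutes, Algebra.algebraMap_eq_smul_one,
          TensorProduct.smul_tmul']
        simp
      | succ i =>
        rw [algebraMapInv_eq_zero (Nat.succ_pos i) ht, zero_smul, sub_zero]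
        rw [show 𝒜 (i + 1) = _ from pow_succ _ _] at ht
        induction ht using Submodule.mul_induction_on' with
        | add x _ y _ hx hy => rw [map_add, TensorProduct.add_tmul]; exact add_mem hx hy
        | mem_mul_mem u _ z hz =>
          have hz' : z ∈ tensorPiece k Z (koszulStep N 0) := by
            simpa [koszulStep, tensorPiece] using hz
          obtain ⟨ξ, rfl⟩ := exists_toTensorAlgebra_eq hz'
          -- In degree one no `a`, `b` satisfy `a + N + b = 1`, so every `ξ` lies in the Koszul
          -- space.
          have hdeg : koszulStep N 0 + koszulDegree N 0 = 1 := by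
            simp [koszulStep, koszulDegree]
          obtain ⟨w, hw⟩ := mem_range_koszulIncl (N := N) (r := r) (s := s)
            (j := koszulStep N 0 + koszulDegree N 0)
            (t := TensorPower.toTensorAlgebra ξ) |>.mpr
              ⟨hz', fun a b h => by omega⟩
          have hsplit : koszulSplit N r s _ _ w = ξ ⊗ₜ w₀ := by
            apply koszulMul_injective
            rw [koszulMul_koszulSplit, hw, koszulMul_tmul, hw₀, mul_one]
          refine ⟨q u ⊗ₜ w, ?_⟩
          rw [LinearMap.restrictScalars_apply, koszulMap_tmul, koszulSymbol, LinearMap.comp_apply,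
            hsplit, LinearMap.rTensor_tmul, TensorProduct.smul_tmul', map_mul]
          rfl
  have key' : ∀ y : A ⊗[k] koszulSpace N r s (koszulDegree N 0),
      y - koszulAug ε N r s _ y • (1 ⊗ₜ[k] w₀) ∈ LinearMap.range D := by
    intro y
    induction y with
    | zero => simp
    | add y y' h h' => rw [map_add, add_smul, add_sub_add_comm]; exact add_mem h h'
    | tmul a w =>
      obtain ⟨c, hc⟩ := exists_koszulIncl_eq_algebraMap w
      obtain rfl : w = c • w₀ := by
        apply koszulIncl_injective
        rw [hc, map_smul, hw₀, Algebra.algebraMap_eq_smul_one]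
      obtain ⟨t, rfl⟩ := hq a
      have := Submodule.smul_mem _ c (key t)
      rw [smul_sub] at this
      convert this using 2
      · rw [TensorProduct.tmul_smul]
      · rw [koszulAug_tmul, hc, AlgHom.commutes, hε, smul_smul, mul_comm]
        rfl
  have := key' x
  rw [hx, zero_smul, sub_zero] at this
  exact this

/-- The Koszul resolution of the trivial module. -/
noncomputable def koszulResolution (hN : 2 ≤ N) (hq : Function.Surjective q)
    (hε : ∀ t, ε (q t) = TensorAlgebra.algebraMapInv t)
    (hK : ∀ i, Function.Exact (koszulMap q N r s (koszulStep N (i + 1)) (koszulDegree N (i + 1)))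
      (koszulMap q N r s (koszulStep N i) (koszulDegree N i))) : ProjResolution ε where
  P i := A ⊗[k] koszulSpace N r s (koszulDegree N i)
  projective i := inferInstance
  diff i := koszulMap q N r s (koszulStep N i) (koszulDegree N i)
  aug := koszulAug ε N r s (koszulDegree N 0)
  aug_smul := koszulAug_smul
  aug_surjective := by
    obtain ⟨w, hw⟩ := exists_koszulIncl_eq_one hN s
    intro c
    refine ⟨c • (1 ⊗ₜ w), ?_⟩
    rw [map_smul, koszulAug_tmul, hw]
    simp
  exact_zero := koszulAug_exact hN s hq hε
  exact_succ := hK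

theorem koszulResolution_isMinimal (hN : 2 ≤ N) (hq : Function.Surjective q)
    (hε : ∀ t, ε (q t) = TensorAlgebra.algebraMapInv t)
    (hK : ∀ i, Function.Exact (koszulMap q N r s (koszulStep N (i + 1)) (koszulDegree N (i + 1)))
      (koszulMap q N r s (koszulStep N i) (koszulDegree N i))) :
    (koszulResolution hN hq hε hK).IsMinimal :=
  fun _ _ _ i _ hb x => cochain_koszulMap_eq_zero hε (koszulStep_pos hN i) hb x

/-! ### The last term of the Koszul resolution -/

/-- Linear forms on `W` are the same as cochains on `A ⊗ W`, so the bound on the global dimension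
and minimality kill the term after the last. The last differential is then injective, and
scalar-valued forms on `W_{δ(n+1)}` extend to `A`-linear forms that survive reduction by `ε`, hence
embed into the one-dimensional `Ext^{n+1}(k, A)`. -/
theorem finrank_koszulSpace_le_one [FiniteDimensional k Z] {n : ℕ} (hN : 2 ≤ N)
    (hq : Function.Surjective q)
    (hε : ∀ t, ε (q t) = TensorAlgebra.algebraMapInv t)
    (hK : ∀ i, Function.Exact (koszulMap q N r s (koszulStep N (i + 1)) (koszulDegree N (i + 1)))
      (koszulMap q N r s (koszulStep N i) (koszulDegree N i)))
    (hreg : IsLeftASRegular ε (n + 1)) :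
    Module.finrank k (koszulSpace N r s (koszulDegree N (n + 1))) ≤ 1 := by
  have hmin := koszulResolution_isMinimal hN hq hε hK
  have hsub : Subsingleton (koszulSpace N r s (koszulDegree N (n + 2))) := by
    rw [← Module.subsingleton_dual_iff k]
    have h : ∀ u : Module.Dual k (koszulSpace N r s (koszulDegree N (n + 2))), u = 0 := by
      intro u
      let g : A ⊗[k] koszulSpace N r s (koszulDegree N (n + 2)) →ₗ[k] k :=
        (TensorProduct.lid k k).toLinearMap ∘ₗ TensorProduct.map ε.toLinearMap u
      have hg : ∀ a x, g (a • x) = ε a • g x := by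
        intro a x
        induction x with
        | zero => simp
        | add x y hx hy => simp only [smul_add, map_add, hx, hy]
        | tmul b w => simp [g, TensorProduct.smul_tmul', mul_assoc]
      have h : g = 0 := hmin.cochain_eq_zero (hreg.gldim_le _) hg
      ext w
      have := LinearMap.congr_fun h (1 ⊗ₜ w)
      simpa [g] using this
    exact ⟨fun u v => by rw [h u, h v]⟩
  have hinj : Function.Injective ((koszulResolution hN hq hε hK).diff n) := by
    refine (injective_iff_map_eq_zero _).mpr fun x hx => ?_
    obtain ⟨y, rfl⟩ := ((koszulResolution hN hq hε hK).exact_succ n x).mp hx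
    have : Subsingleton ((koszulResolution hN hq hε hK).P (n + 2)) :=
      inferInstanceAs (Subsingleton (A ⊗[k] koszulSpace N r s (koszulDegree N (n + 2))))
    rw [Subsingleton.elim y 0, map_zero]
  let l : Module.Dual k (koszulSpace N r s (koszulDegree N (n + 1))) →+
      (A ⊗[k] koszulSpace N r s (koszulDegree N (n + 1)) →ₗ[A] A) :=
    { toFun := fun u => freeLift (Algebra.linearMap k A ∘ₗ u)
      map_zero' := by
        ext
        simp [freeLift_tmul]
      map_add' := fun u v => by
        ext
        simp [freeLift_tmul] }
  have hl : ∀ u a w, l u (a ⊗ₜ w) = a * algebraMap k A (u w) := fun u a w => rfl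
  have hl_smul : ∀ (c : k) u x, l (c • u) x = c • l u x := fun c u x => by
    induction x with
    | zero => rw [map_zero, map_zero, smul_zero]
    | add x y hx hy => rw [map_add, hx, hy, ← smul_add, ← map_add]
    | tmul a w =>
      rw [hl, hl, LinearMap.smul_apply, smul_eq_mul, map_mul, Algebra.left_comm, Algebra.smul_def]
  obtain ⟨θ, hθ⟩ := hmin.exists_injective_ext hinj l hl_smul (fun u hu => by
    ext w
    have h : ε (l u (1 ⊗ₜ w)) = 0 := hu (1 ⊗ₜ w)
    rw [hl, one_mul, AlgHom.commutes] at h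
    exact h)
  have hfin : Module.Finite k (CategoryTheory.Abelian.Ext (trivialModule ε)
      (ModuleCat.of A A) (n + 1)) :=
    Module.finite_of_finrank_eq_succ hreg.ext_one_dim
  have := LinearMap.finrank_le_finrank_of_injective hθ
  rwa [hreg.ext_one_dim, Subspace.dual_finrank_eq] at this

end Koszul

/-! ### Koszulity of `A(s, N)` in terms of the complex `A ⊗ W`. -/

section SuperpotentialAlgebra

variable {k Z : Type u} [Field k] [AddCommGroup Z] [Module k Z]

theorem koszulDifferential_tmul (N r : ℕ) (s : ⨂[k]^(N + r) Z) (p j : ℕ)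
    (a : SuperpotentialAlgebra N r s) (ξ : (⨂[k]^p Z) ⊗[k] (⨂[k]^j Z)) :
    koszulDifferential N r s p j (a ⊗ₜ TensorPower.mulEquiv ξ) =
      a • LinearMap.rTensor (⨂[k]^j Z) ((quotientMap N r s).toLinearMap ∘ₗ
        TensorPower.toTensorAlgebra) ξ := by
  induction ξ with
  | zero => simp
  | add x y hx hy => rw [map_add, TensorProduct.tmul_add, map_add, hx, hy, map_add, smul_add]
  | tmul x y => simp [koszulDifferential, TensorProduct.smul_tmul']

theorem lTensor_subtype_koszulMap {N r : ℕ} {s : ⨂[k]^(N + r) Z} {p j : ℕ}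
    (x : SuperpotentialAlgebra N r s ⊗[k] koszulSpace N r s (p + j)) :
    LinearMap.lTensor (SuperpotentialAlgebra N r s) (koszulSpace N r s j).subtype
      (koszulMap (quotientMap N r s) N r s p j x) = koszulDifferential N r s p j
        (LinearMap.lTensor (SuperpotentialAlgebra N r s) (koszulSpace N r s (p + j)).subtype x) := by
  induction x with
  | zero => simp
  | add x y hx hy => simp only [map_add, hx, hy]
  | tmul a w =>
    rw [koszulMap_tmul, LinearMap.lTensor_tmul, Submodule.subtype_apply,
      ← mulEquiv_koszulSplit w, koszulDifferential_tmul, koszulSymbol, LinearMap.comp_apply]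
    generalize koszulSplit N r s p j w = ξ
    induction ξ with
    | zero => simp
    | add x y hx hy => simp only [map_add, smul_add, hx, hy]
    | tmul x y => simp [TensorProduct.smul_tmul']

/-- By flatness `A ⊗ W_j` embeds into `A ⊗ Z^{⊗ j}`, with image the Koszul term, and the embeddings
intertwine the differentials; so exactness transfers. -/
theorem IsNKoszul.exact_koszulMap {N r : ℕ} {s : ⨂[k]^(N + r) Z} (hK : IsNKoszul N r s) (i : ℕ) :
    Function.Exact
      (koszulMap (quotientMap N r s) N r s (koszulStep N (i + 1)) (koszulDegree N (i + 1)))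
      (koszulMap (quotientMap N r s) N r s (koszulStep N i) (koszulDegree N i)) := by
  intro x
  have hinj : ∀ j, Function.Injective (LinearMap.lTensor (SuperpotentialAlgebra N r s)
      (koszulSpace N r s j).subtype) := fun j =>
    Module.Flat.lTensor_preserves_injective_linearMap _ Subtype.val_injective
  have h := hK i (LinearMap.lTensor _ (koszulSpace N r s _).subtype x) ⟨x, rfl⟩
  have h₁ := lTensor_subtype_koszulMap (p := koszulStep N i) (j := koszulDegree N i) x
  constructor
  · intro hx
    rw [hx, map_zero] at h₁
    obtain ⟨_, ⟨y, rfl⟩, hy⟩ := h.mp h₁.symm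
    exact ⟨y, hinj _ ((lTensor_subtype_koszulMap (p := koszulStep N (i + 1)) y).trans hy)⟩
  · rintro ⟨y, rfl⟩
    have h₂ := h.mpr ⟨_, ⟨y, rfl⟩,
      (lTensor_subtype_koszulMap (p := koszulStep N (i + 1)) y).symm⟩
    exact hinj _ ((h₁.trans h₂).trans (map_zero _).symm)

theorem augmentation_quotientMap {N r : ℕ} (hN : 2 ≤ N) (s : ⨂[k]^(N + r) Z)
    (t : TensorAlgebra k Z) :
    augmentation N r hN s (quotientMap N r s t) = TensorAlgebra.algebraMapInv t :=
  RingQuot.liftAlgHom_mkAlgHom_apply k _ _ t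

end SuperpotentialAlgebra

/-! ### The coaction on the Koszul resolution. -/

section KoszulCoaction

variable {k : Type u} [Field k] {A H : Type u} [Ring A] [Algebra k A] [Ring H]

/-- The coaction `a ⊗ w ↦ a₀ ⊗ w₀ ⊗ a₁ w₁` on `A ⊗ W`. -/
noncomputable def freeCoact [Algebra k H] (ρ : A →ₐ[k] A ⊗[k] H) {W : Type u} [AddCommGroup W]
    [Module k W] (f : W →ₗ[k] W ⊗[k] H) : A ⊗[k] W →ₗ[k] (A ⊗[k] W) ⊗[k] H :=
  TensorProduct.lift ((tensorAct A H (A ⊗[k] W)).compl₁₂ ρ.toLinearMap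
    (LinearMap.rTensor H (TensorProduct.mk k A W 1) ∘ₗ f))

section

variable [Algebra k H] {ρ : A →ₐ[k] A ⊗[k] H} {W : Type u} [AddCommGroup W] [Module k W]
  {f : W →ₗ[k] W ⊗[k] H}

theorem freeCoact_tmul (a : A) (w : W) : freeCoact ρ f (a ⊗ₜ w) =
    tensorAct A H (A ⊗[k] W) (ρ a) (LinearMap.rTensor H (TensorProduct.mk k A W 1) (f w)) := rfl

theorem freeCoact_smul (a : A) (x : A ⊗[k] W) :
    freeCoact ρ f (a • x) = tensorAct A H (A ⊗[k] W) (ρ a) (freeCoact ρ f x) := by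
  induction x with
  | zero => simp
  | add x y hx hy => rw [smul_add, map_add, hx, hy, map_add, map_add]
  | tmul b w => rw [TensorProduct.smul_tmul', freeCoact_tmul, freeCoact_tmul, smul_eq_mul,
      map_mul, tensorAct_mul]

end

variable [HopfAlgebra k H] {Z : Type u} [AddCommGroup Z] [Module k Z]
  {q : TensorAlgebra k Z →ₐ[k] A} {ρ : A →ₐ[k] A ⊗[k] H}
  {τ : TensorAlgebra k Z →ₐ[k] TensorAlgebra k Z ⊗[k] H}
  {N r : ℕ} {s : ⨂[k]^(N + r) Z}

theorem exists_coact_tensorPower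
    (hZ : ∀ p, IsRightSubcomodule τ.toLinearMap (tensorPiece k Z p)) (p : ℕ) :
    ∃ g : (⨂[k]^p Z) →ₗ[k] (⨂[k]^p Z) ⊗[k] H, ∀ x,
      LinearMap.rTensor H TensorPower.toTensorAlgebra (g x) =
        τ (TensorPower.toTensorAlgebra x) := by
  obtain ⟨g, hg⟩ := exists_rTensor_comp_eq _ (toTensorAlgebra_injective (k := k) (Z := Z) p)
    (τ.toLinearMap ∘ₗ TensorPower.toTensorAlgebra) (fun x => by
      rw [range_toTensorAlgebra]
      exact hZ p _ (toTensorAlgebra_mem x))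
  exact ⟨g, LinearMap.congr_fun hg⟩

theorem exists_coact_koszulSpace
    (hW : ∀ j, IsRightSubcomodule τ.toLinearMap (LinearMap.range (koszulIncl N r s j))) (j : ℕ) :
    ∃ f : koszulSpace N r s j →ₗ[k] koszulSpace N r s j ⊗[k] H, ∀ w,
      LinearMap.rTensor H (koszulIncl N r s j) (f w) = τ (koszulIncl N r s j w) := by
  obtain ⟨g, hg⟩ := exists_rTensor_comp_eq _ (koszulIncl_injective N r s j)
    (τ.toLinearMap ∘ₗ koszulIncl N r s j) (fun x => hW j _ ⟨x, rfl⟩)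
  exact ⟨g, LinearMap.congr_fun hg⟩

/-- Colinearity of the inclusion `W_{p+j} → Z^{⊗ p} ⊗ W_j`. Multiplication into `T Z` is injective,
and there the claim is the multiplicativity of `τ`. -/
theorem rTensor_koszulSplit_coact {p j : ℕ} {g : (⨂[k]^p Z) →ₗ[k] (⨂[k]^p Z) ⊗[k] H}
    (hg : ∀ x, LinearMap.rTensor H TensorPower.toTensorAlgebra (g x) =
        τ (TensorPower.toTensorAlgebra x))
    {f : ∀ j, koszulSpace N r s j →ₗ[k] koszulSpace N r s j ⊗[k] H}
    (hf : ∀ j w, LinearMap.rTensor H (koszulIncl N r s j) (f j w) = τ (koszulIncl N r s j w))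
    (w : koszulSpace N r s (p + j)) :
    LinearMap.rTensor H (koszulSplit N r s p j) (f (p + j) w) =
      TensorProduct.lift ((TensorProduct.map₂ (TensorProduct.mk k (⨂[k]^p Z)
        (koszulSpace N r s j)) (LinearMap.mul k H)).compl₁₂ g (f j)) (koszulSplit N r s p j w) := by
  apply Module.Flat.rTensor_preserves_injective_linearMap (M := H) _ (koszulMul_injective N r s p j)
  have h₁ : koszulMul N r s p j ∘ₗ koszulSplit N r s p j = koszulIncl N r s (p + j) :=
    LinearMap.ext koszulMul_koszulSplit
  rw [← LinearMap.rTensor_comp_apply, h₁, hf, ← koszulMul_koszulSplit]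
  generalize koszulSplit N r s p j w = ξ
  induction ξ with
  | zero => simp
  | add x y hx hy => simp only [map_add, hx, hy]
  | tmul x y =>
    rw [TensorProduct.lift.tmul, LinearMap.compl₁₂_apply, koszulMul_tmul, map_mul, ← hg, ← hf]
    generalize g x = α
    generalize f j y = β
    induction α with
    | zero => simp
    | add α α' h h' => simp only [map_add, LinearMap.add_apply, add_mul, h, h']
    | tmul a h =>
      induction β with
      | zero => simp
      | add β β' h h' => simp only [map_add, mul_add, h, h']
      | tmul b h' => simp [koszulMul_tmul]

theorem freeCoact_koszulSymbol (hq : ∀ t, LinearMap.rTensor H q.toLinearMap (τ t) = ρ (q t))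
    {p j : ℕ} {g : (⨂[k]^p Z) →ₗ[k] (⨂[k]^p Z) ⊗[k] H}
    (hg : ∀ x, LinearMap.rTensor H TensorPower.toTensorAlgebra (g x) =
        τ (TensorPower.toTensorAlgebra x))
    {f : ∀ j, koszulSpace N r s j →ₗ[k] koszulSpace N r s j ⊗[k] H}
    (hf : ∀ j w, LinearMap.rTensor H (koszulIncl N r s j) (f j w) = τ (koszulIncl N r s j w))
    (w : koszulSpace N r s (p + j)) :
    freeCoact ρ (f j) (koszulSymbol q N r s p j w) =
      LinearMap.rTensor H (koszulSymbol q N r s p j) (f (p + j) w) := by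
  rw [koszulSymbol, LinearMap.rTensor_comp_apply, rTensor_koszulSplit_coact hg hf,
    LinearMap.comp_apply]
  generalize koszulSplit N r s p j w = ξ
  induction ξ with
  | zero => simp
  | add x y hx hy => simp only [map_add, hx, hy]
  | tmul x y =>
    rw [LinearMap.rTensor_tmul, freeCoact_tmul, TensorProduct.lift.tmul, LinearMap.compl₁₂_apply,
      LinearMap.comp_apply, AlgHom.toLinearMap_apply, ← hq, ← hg]
    generalize g x = α
    generalize f j y = β
    induction α with
    | zero => simp
    | add α α' h h' => simp only [map_add, LinearMap.add_apply, h, h']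
    | tmul a h =>
      induction β with
      | zero => simp
      | add β β' h h' => simp only [map_add, h, h']
      | tmul b h' => simp [tensorAct, TensorProduct.smul_tmul']

theorem freeCoact_koszulMap (hq : ∀ t, LinearMap.rTensor H q.toLinearMap (τ t) = ρ (q t))
    {p j : ℕ} {g : (⨂[k]^p Z) →ₗ[k] (⨂[k]^p Z) ⊗[k] H}
    (hg : ∀ x, LinearMap.rTensor H TensorPower.toTensorAlgebra (g x) =
        τ (TensorPower.toTensorAlgebra x))
    {f : ∀ j, koszulSpace N r s j →ₗ[k] koszulSpace N r s j ⊗[k] H}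
    (hf : ∀ j w, LinearMap.rTensor H (koszulIncl N r s j) (f j w) = τ (koszulIncl N r s j w))
    (x : A ⊗[k] koszulSpace N r s (p + j)) :
    freeCoact ρ (f j) (koszulMap q N r s p j x) =
      LinearMap.rTensor H ((koszulMap q N r s p j).restrictScalars k)
        (freeCoact ρ (f (p + j)) x) := by
  induction x with
  | zero => simp
  | add x y hx hy => simp only [map_add, hx, hy]
  | tmul a w =>
    rw [koszulMap_tmul, freeCoact_smul, freeCoact_koszulSymbol hq hg hf, freeCoact_tmul,
      rTensor_tensorAct, ← LinearMap.rTensor_comp_apply]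
    congr 3
    ext w
    simp [koszulMap_tmul]

theorem rTensor_koszulAug_freeCoact {ε : A →ₐ[k] k}
    (hρ : ∀ a, TensorProduct.lid k H (LinearMap.rTensor H ε.toLinearMap (ρ a)) = ε a • (1 : H))
    {f : koszulSpace N r s (koszulDegree N 0) →ₗ[k] koszulSpace N r s (koszulDegree N 0) ⊗[k] H}
    (hf : ∀ w, LinearMap.rTensor H (koszulIncl N r s _) (f w) = τ (koszulIncl N r s _ w))
    (x : A ⊗[k] koszulSpace N r s (koszulDegree N 0)) :
    LinearMap.rTensor H (koszulAug ε N r s _) (freeCoact ρ f x) =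
      koszulAug ε N r s _ x ⊗ₜ[k] (1 : H) := by
  induction x with
  | zero => simp
  | add x y hx hy => simp only [map_add, hx, hy, TensorProduct.add_tmul]
  | tmul a w =>
    apply (TensorProduct.lid k H).injective
    rw [freeCoact_tmul, lid_rTensor_tensorAct (V := H) (ε := ε) koszulAug_smul, hρ,
      ← LinearMap.rTensor_comp_apply, koszulAug_tmul, TensorProduct.lid_tmul, mul_smul,
      smul_one_mul]
    congr 1
    have h : koszulAug ε N r s (koszulDegree N 0) ∘ₗ TensorProduct.mk k A _ 1 =
        TensorAlgebra.algebraMapInv.toLinearMap ∘ₗ koszulIncl N r s _ := by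
      ext w
      simp [koszulAug_tmul]
    rw [h, LinearMap.rTensor_comp_apply, hf]
    obtain ⟨c, hc⟩ := exists_koszulIncl_eq_algebraMap w
    rw [hc, AlgHom.commutes, Algebra.TensorProduct.algebraMap_apply, LinearMap.rTensor_tmul,
      TensorProduct.lid_tmul]
    rfl

/-- The coaction on the Koszul resolution. -/
noncomputable def koszulCoaction (hN : 2 ≤ N) {ε : A →ₐ[k] k} (hqs : Function.Surjective q)
    (hε : ∀ t, ε (q t) = TensorAlgebra.algebraMapInv t)
    (hK : ∀ i, Function.Exact (koszulMap q N r s (koszulStep N (i + 1)) (koszulDegree N (i + 1)))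
      (koszulMap q N r s (koszulStep N i) (koszulDegree N i)))
    (hq : ∀ t, LinearMap.rTensor H q.toLinearMap (τ t) = ρ (q t))
    (hρ : ∀ a, TensorProduct.lid k H (LinearMap.rTensor H ε.toLinearMap (ρ a)) = ε a • (1 : H))
    (hZ : ∀ p, IsRightSubcomodule τ.toLinearMap (tensorPiece k Z p))
    {f : ∀ j, koszulSpace N r s j →ₗ[k] koszulSpace N r s j ⊗[k] H}
    (hf : ∀ j w, LinearMap.rTensor H (koszulIncl N r s j) (f j w) = τ (koszulIncl N r s j w)) :
    CompatibleCoaction ρ (koszulResolution hN hqs hε hK) where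
  coact i := freeCoact ρ (f (koszulDegree N i))
  coact_smul _ := freeCoact_smul
  coact_diff _ := freeCoact_koszulMap hq (exists_coact_tensorPower hZ _).choose_spec hf
  coact_aug := rTensor_koszulAug_freeCoact hρ (hf _)

end KoszulCoaction

/-! ### The coaction on the last Koszul term and on the top cohomology class. -/

section Top

variable {k Z : Type u} [Field k] [AddCommGroup Z] [Module k Z]
  {A H : Type u} [Ring A] [Algebra k A] [Ring H] [HopfAlgebra k H]
  {q : TensorAlgebra k Z →ₐ[k] A} {ρ : A →ₐ[k] A ⊗[k] H}
  {τ : TensorAlgebra k Z →ₐ[k] TensorAlgebra k Z ⊗[k] H}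
  {N r n : ℕ} {s : ⨂[k]^(N + r) Z} {ε : A →ₐ[k] k}

theorem exists_coact_eq_tmul [FiniteDimensional k Z] (hN : 2 ≤ N) (hs : IsTwistedSuperpotential s)
    (hm : N + r = koszulDegree N (n + 1)) (hqs : Function.Surjective q)
    (hε : ∀ t, ε (q t) = TensorAlgebra.algebraMapInv t)
    (hK : ∀ i, Function.Exact (koszulMap q N r s (koszulStep N (i + 1)) (koszulDegree N (i + 1)))
      (koszulMap q N r s (koszulStep N i) (koszulDegree N i)))
    (hreg : IsLeftASRegular ε (n + 1))
    (hq : ∀ t, LinearMap.rTensor H q.toLinearMap (τ t) = ρ (q t))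
    (hρ : ∀ a, TensorProduct.lid k H (LinearMap.rTensor H ε.toLinearMap (ρ a)) = ε a • (1 : H))
    (hZ : ∀ p, IsRightSubcomodule τ.toLinearMap (tensorPiece k Z p))
    (hW : ∀ j, IsRightSubcomodule τ.toLinearMap (LinearMap.range (koszulIncl N r s j)))
    {Q : ProjResolution ε} (cQ : CompatibleCoaction ρ Q) {e : Q.P (n + 1) →ₗ[k] k}
    (he : Q.IsCocycle e) (he' : ¬ Q.IsCoboundary e) :
    s ≠ 0 ∧ ∃ h : H, τ (inTensorAlgebra s) = inTensorAlgebra s ⊗ₜ h ∧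
      ∃ y : Q.P (n + 1), e y ≠ 0 ∧
        TensorProduct.lid k H (LinearMap.rTensor H e (cQ.coact (n + 1) y)) = e y • h ∧
        ∀ (V : Type u) [AddCommGroup V] [Module k V] (b : Q.P (n + 1) →ₗ[k] V),
          Q.IsCoboundary b → b y = 0 := by
  choose f hf using exists_coact_koszulSpace hW
  let cK := koszulCoaction hN hqs hε hK hq hρ hZ hf
  obtain ⟨F, ⟨x, hx⟩, hF, hF'⟩ := exists_chainMap_coact_eq ρ hρ cK cQ
    (koszulResolution_isMinimal hN hqs hε hK) he he'
  let W := koszulSpace N r s (koszulDegree N (n + 1))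
  let G : A ⊗[k] W →ₗ[k] k := e ∘ₗ F.restrictScalars k
  have hG : ∀ a y, G (a • y) = ε a * G y := he.1.comp F
  -- A cochain on a free module is determined by its values on the generators `1 ⊗ w`.
  obtain ⟨w, hw⟩ : ∃ w : W, G (1 ⊗ₜ w) ≠ 0 := by
    by_contra! h
    refine hx ((?_ : ∀ x : A ⊗[k] W, G x = 0) x)
    intro x
    induction x with
    | zero => exact map_zero G
    | add x y hx hy => rw [map_add, hx, hy, add_zero]
    | tmul a w =>
      have := hG a (1 ⊗ₜ w)
      rwa [h, mul_zero, TensorProduct.smul_tmul', smul_eq_mul, mul_one] at this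
  have hs₀ : s ≠ 0 := by
    rintro rfl
    have hbot := koszulSpace_zero (k := k) (Z := Z) N r
      (show N ≤ koszulDegree N (n + 1) by omega)
    have hw0 : w = 0 := Subtype.ext ((Submodule.mem_bot k).mp (hbot ▸ w.2))
    exact hw (by rw [hw0, TensorProduct.tmul_zero, map_zero])
  have hmem : inTensorAlgebra s ∈ LinearMap.range (koszulIncl N r s (koszulDegree N (n + 1))) := by
    rw [← hm]
    exact ⟨⟨s, hs.mem_koszulSpace⟩, rfl⟩
  obtain ⟨σ, hσ⟩ := hmem
  have hσ₀ : σ ≠ 0 := by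
    rintro rfl
    rw [map_zero] at hσ
    exact hs₀ (toTensorAlgebra_injective _ (hσ.symm.trans (map_zero _).symm))
  have hfin : Module.Finite k W := by
    have : Module.Finite k (⨂[k]^(koszulDegree N (n + 1)) Z) := inferInstance
    infer_instance
  -- The bound from regularity and the nonzero element `σ` together make `W` the line through `s`.
  have hspan : ∀ w : W, ∃ c : k, c • σ = w :=
    exists_smul_eq_of_finrank_eq_one
      (le_antisymm (finrank_koszulSpace_le_one hN hqs hε hK hreg)
        (Module.finrank_pos_iff_exists_ne_zero.mpr ⟨σ, hσ₀⟩)) hσ₀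
  have hspan' : ∀ y : W ⊗[k] H, ∃ h : H, y = σ ⊗ₜ h := by
    intro y
    induction y with
    | zero => exact ⟨0, by simp⟩
    | add y y' hy hy' =>
      obtain ⟨h, rfl⟩ := hy
      obtain ⟨h', rfl⟩ := hy'
      exact ⟨h + h', (TensorProduct.tmul_add _ _ _).symm⟩
    | tmul w h =>
      obtain ⟨c, rfl⟩ := hspan w
      exact ⟨c • h, TensorProduct.smul_tmul _ _ _⟩
  obtain ⟨h, hh⟩ := hspan' (f _ σ)
  refine ⟨hs₀, h, ?_, F (1 ⊗ₜ σ), ?_, ?_, fun V _ _ b hb => hF' V b hb _⟩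
  · rw [← hσ, ← hf, hh, LinearMap.rTensor_tmul]
  · obtain ⟨c, rfl⟩ := hspan w
    intro h0
    apply hw
    rw [TensorProduct.tmul_smul, map_smul]
    exact (congrArg (c • ·) h0).trans (smul_zero c)
  -- On `1 ⊗ σ` the Koszul coaction is just the coaction of `σ`, so the comparison gives `e (F (1 ⊗
  -- σ)) • h`.
  · refine (hF (1 ⊗ₜ σ)).trans ?_
    change TensorProduct.lid k H (LinearMap.rTensor H G (freeCoact ρ (f _) (1 ⊗ₜ σ))) =
      G (1 ⊗ₜ σ) • h
    rw [freeCoact_tmul, map_one, tensorAct_one, hh, LinearMap.rTensor_tmul, LinearMap.rTensor_tmul,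
      TensorProduct.lid_tmul]
    rfl

end Top

/-! ### The multiplicative extension of the coaction to `T Z`. -/

section LiftCoaction

variable {k Z : Type u} [Field k] [AddCommGroup Z] [Module k Z]
  {A H : Type u} [Ring A] [Algebra k A] [Ring H] [HopfAlgebra k H]

/-- The multiplicative extension to `T Z` of the coaction of `A` on `A₁ = Z`. -/
noncomputable def liftCoaction (q : TensorAlgebra k Z →ₐ[k] A) (deg : A →ₗ[k] Z)
    (ρ : A →ₐ[k] A ⊗[k] H) : TensorAlgebra k Z →ₐ[k] TensorAlgebra k Z ⊗[k] H :=
  TensorAlgebra.lift k (LinearMap.rTensor H (TensorAlgebra.ι k ∘ₗ deg) ∘ₗ ρ.toLinearMap ∘ₗ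
    q.toLinearMap ∘ₗ TensorAlgebra.ι k)

variable {q : TensorAlgebra k Z →ₐ[k] A} {deg : A →ₗ[k] Z} {ρ : A →ₐ[k] A ⊗[k] H}

theorem liftCoaction_ι (z : Z) : liftCoaction q deg ρ (TensorAlgebra.ι k z) =
    LinearMap.rTensor H (TensorAlgebra.ι k ∘ₗ deg) (ρ (q (TensorAlgebra.ι k z))) :=
  TensorAlgebra.lift_ι_apply _ _

/-- As `ρ` preserves the grading, `ρ z` lies in `A₁ ⊗ H`, where only the values of `f` and `g` on
`A₁` matter. -/
theorem rTensor_coact_congr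
    (hgr : IsRightSubcomodule ρ.toLinearMap ((tensorPiece k Z 1).map q.toLinearMap))
    {M : Type u} [AddCommGroup M] [Module k M] {f g : A →ₗ[k] M}
    (hfg : ∀ z, f (q (TensorAlgebra.ι k z)) = g (q (TensorAlgebra.ι k z))) (z : Z) :
    LinearMap.rTensor H f (ρ (q (TensorAlgebra.ι k z))) =
      LinearMap.rTensor H g (ρ (q (TensorAlgebra.ι k z))) := by
  obtain ⟨y, hy⟩ := hgr (q (TensorAlgebra.ι k z))
    ⟨_, by rw [tensorPiece, pow_one]; exact ⟨z, rfl⟩, rfl⟩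
  rw [← AlgHom.toLinearMap_apply ρ, ← hy, ← LinearMap.rTensor_comp_apply,
    ← LinearMap.rTensor_comp_apply]
  congr 2
  ext ⟨a, t, ht, rfl⟩
  rw [tensorPiece, pow_one] at ht
  obtain ⟨z, rfl⟩ := ht
  exact hfg z

theorem rTensor_liftCoaction
    (hgr : IsRightSubcomodule ρ.toLinearMap ((tensorPiece k Z 1).map q.toLinearMap))
    (hdeg : ∀ z, deg (q (TensorAlgebra.ι k z)) = z) (t : TensorAlgebra k Z) :
    LinearMap.rTensor H q.toLinearMap (liftCoaction q deg ρ t) = ρ (q t) := by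
  have h : (Algebra.TensorProduct.map q (AlgHom.id k H)).comp (liftCoaction q deg ρ) =
      ρ.comp q := by
    ext z
    change LinearMap.rTensor H q.toLinearMap (liftCoaction q deg ρ (TensorAlgebra.ι k z)) =
      ρ (q (TensorAlgebra.ι k z))
    rw [liftCoaction_ι, ← LinearMap.rTensor_comp_apply,
      rTensor_coact_congr (g := LinearMap.id) hgr (fun z => by simp [hdeg]), LinearMap.rTensor_id]
    rfl
  exact AlgHom.congr_fun h t

theorem lid_rTensor_coact {ε : A →ₐ[k] k}
    (hgr : IsRightSubcomodule ρ.toLinearMap ((tensorPiece k Z 1).map q.toLinearMap))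
    (hqs : Function.Surjective q) (hε : ∀ t, ε (q t) = TensorAlgebra.algebraMapInv t) (a : A) :
    TensorProduct.lid k H (LinearMap.rTensor H ε.toLinearMap (ρ a)) = ε a • (1 : H) := by
  have hι : ∀ z, ε (q (TensorAlgebra.ι k z)) = 0 := fun z => by
    rw [hε]
    simp [TensorAlgebra.algebraMapInv]
  have h : ((Algebra.TensorProduct.lid k H).toAlgHom.comp
      ((Algebra.TensorProduct.map ε (AlgHom.id k H)).comp ρ)).comp q =
      ((Algebra.ofId k H).comp ε).comp q := by
    ext z
    change TensorProduct.lid k H (LinearMap.rTensor H ε.toLinearMap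
      (ρ (q (TensorAlgebra.ι k z)))) = algebraMap k H (ε (q (TensorAlgebra.ι k z)))
    rw [rTensor_coact_congr (g := 0) hgr hι, hι]
    simp
  obtain ⟨t, rfl⟩ := hqs a
  rw [← Algebra.algebraMap_eq_smul_one]
  exact AlgHom.congr_fun h t

theorem isRightSubcomodule_tensorPiece (p : ℕ) :
    IsRightSubcomodule (liftCoaction q deg ρ).toLinearMap (tensorPiece k Z p) := by
  refine IsRightSubcomodule.pow ?_ p
  rintro _ ⟨z, rfl⟩
  rw [AlgHom.toLinearMap_apply, liftCoaction_ι, mem_range_rTensor_iff]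
  intro φ
  rw [slice_rTensor]
  exact ⟨_, rfl⟩

variable {N r : ℕ} {s : ⨂[k]^(N + r) Z}

/-- `R` is the degree `N` part of `ker q`; the lifted coaction preserves the degree and `q`
intertwines it with `ρ`. -/
theorem isRightSubcomodule_relationSpace
    (hgr : IsRightSubcomodule ρ.toLinearMap ((tensorPiece k Z 1).map q.toLinearMap))
    (hdeg : ∀ z, deg (q (TensorAlgebra.ι k z)) = z)
    (hR : ∀ t ∈ tensorPiece k Z N, t ∈ relationSpace N r s ↔ q t = 0) :
    IsRightSubcomodule (liftCoaction q deg ρ).toLinearMap (relationSpace N r s) := by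
  refine .of_slice_mem fun t ht φ => ?_
  have ht' := relationSpace_le N r s ht
  refine (hR _ ((isRightSubcomodule_tensorPiece N).slice_mem ht' φ)).mpr ?_
  have h := slice_rTensor φ q.toLinearMap (liftCoaction q deg ρ t)
  rw [rTensor_liftCoaction hgr hdeg, (hR t ht').mp ht, map_zero, map_zero] at h
  exact h.symm

theorem isRightSubcomodule_koszulIncl
    (hgr : IsRightSubcomodule ρ.toLinearMap ((tensorPiece k Z 1).map q.toLinearMap))
    (hdeg : ∀ z, deg (q (TensorAlgebra.ι k z)) = z)
    (hR : ∀ t ∈ tensorPiece k Z N, t ∈ relationSpace N r s ↔ q t = 0) (j : ℕ) :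
    IsRightSubcomodule (liftCoaction q deg ρ).toLinearMap
      (LinearMap.range (koszulIncl N r s j)) := by
  have hrel := isRightSubcomodule_relationSpace hgr hdeg hR
  refine .of_slice_mem fun t ht φ => ?_
  rw [mem_range_koszulIncl] at ht ⊢
  refine ⟨(isRightSubcomodule_tensorPiece j).slice_mem ht.1 φ, fun a b hab => ?_⟩
  have h := ((isRightSubcomodule_tensorPiece (q := q) (deg := deg) (ρ := ρ) a).mul hrel).mul
    (isRightSubcomodule_tensorPiece b)
  exact h.slice_mem (ht.2 a b hab) φ

theorem slice_counit_liftCoaction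
    (hdeg : ∀ z, deg (q (TensorAlgebra.ι k z)) = z)
    (hco : ∀ a, slice A (Coalgebra.counit (R := k) (A := H)) (ρ a) = a) (t : TensorAlgebra k Z) :
    slice _ (Coalgebra.counit (R := k) (A := H)) (liftCoaction q deg ρ t) = t := by
  have h : ((Algebra.TensorProduct.rid k k (TensorAlgebra k Z)).toAlgHom.comp
      (Algebra.TensorProduct.map (AlgHom.id k _) (Bialgebra.counitAlgHom k H))).comp
      (liftCoaction q deg ρ) = AlgHom.id k _ := by
    ext z
    change slice _ (Coalgebra.counit (R := k) (A := H))
      (liftCoaction q deg ρ (TensorAlgebra.ι k z)) = TensorAlgebra.ι k z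
    rw [liftCoaction_ι, slice_rTensor, hco, LinearMap.comp_apply, hdeg]
  exact AlgHom.congr_fun h t

/-- Two algebra maps on `T Z` are compared on generators. The comultiplication is a parameter so
that the co-opposite one can be used for left coactions. -/
theorem liftCoaction_coassoc
    (hgr : IsRightSubcomodule ρ.toLinearMap ((tensorPiece k Z 1).map q.toLinearMap))
    (hdeg : ∀ z, deg (q (TensorAlgebra.ι k z)) = z) {Δ : H →ₐ[k] H ⊗[k] H}
    (hΔ : ∀ a, TensorProduct.assoc k A H H (LinearMap.rTensor H ρ.toLinearMap (ρ a)) =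
      LinearMap.lTensor A Δ.toLinearMap (ρ a)) (t : TensorAlgebra k Z) :
    TensorProduct.assoc k _ H H (LinearMap.rTensor H (liftCoaction q deg ρ).toLinearMap
      (liftCoaction q deg ρ t)) =
      LinearMap.lTensor _ Δ.toLinearMap (liftCoaction q deg ρ t) := by
  have h : ((Algebra.TensorProduct.assoc k k k (TensorAlgebra k Z) H H).toAlgHom.comp
      (Algebra.TensorProduct.map (liftCoaction q deg ρ) (AlgHom.id k H))).comp
      (liftCoaction q deg ρ) =
      (Algebra.TensorProduct.map (AlgHom.id k _) Δ).comp (liftCoaction q deg ρ) := by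
    ext z
    change TensorProduct.assoc k _ H H (LinearMap.rTensor H (liftCoaction q deg ρ).toLinearMap
        (liftCoaction q deg ρ (TensorAlgebra.ι k z))) =
      LinearMap.lTensor _ Δ.toLinearMap (liftCoaction q deg ρ (TensorAlgebra.ι k z))
    have h₁ : ∀ x : A ⊗[k] H, LinearMap.lTensor _ Δ.toLinearMap
        (LinearMap.rTensor H (TensorAlgebra.ι k ∘ₗ deg) x) =
        LinearMap.rTensor _ (TensorAlgebra.ι k ∘ₗ deg) (LinearMap.lTensor A Δ.toLinearMap x) := by
      intro x
      induction x with
      | zero => simp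
      | add x y hx hy => simp only [map_add, hx, hy]
      | tmul a h => simp
    have h₂ : ∀ x : (A ⊗[k] H) ⊗[k] H,
        LinearMap.rTensor (H ⊗[k] H) (TensorAlgebra.ι k ∘ₗ deg)
          (TensorProduct.assoc k A H H x) =
        TensorProduct.assoc k _ H H (LinearMap.rTensor H
          (LinearMap.rTensor H (TensorAlgebra.ι k ∘ₗ deg)) x) := by
      intro x
      induction x with
      | zero => simp
      | add x y hx hy => simp only [map_add, hx, hy]
      | tmul y h =>
        induction y with
        | zero => simp
        | add x y hx hy => simp only [TensorProduct.add_tmul, map_add, hx, hy]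
        | tmul a h' => simp
    rw [liftCoaction_ι, h₁, ← hΔ, h₂, ← LinearMap.rTensor_comp_apply,
      ← LinearMap.rTensor_comp_apply]
    congr 1
    refine rTensor_coact_congr hgr (fun z => ?_) z
    simp only [LinearMap.comp_apply, hdeg, AlgHom.toLinearMap_apply, liftCoaction_ι]
  exact AlgHom.congr_fun h t

end LiftCoaction

/-! ### The group-like element attached to `s`. -/

section Main

variable {k Z : Type u} [Field k] [AddCommGroup Z] [Module k Z]
  {H : Type u} [Ring H] [HopfAlgebra k H]

theorem tmul_left_injective {M : Type u} [AddCommGroup M] [Module k M] {m : M} (hm : m ≠ 0)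
    {W : Type u} [AddCommGroup W] [Module k W] {x y : W} (h : m ⊗ₜ[k] x = m ⊗ₜ[k] y) : x = y := by
  obtain ⟨φ, hφ⟩ := Module.Projective.exists_dual_eq_one k hm
  simpa [hφ] using congrArg ((TensorProduct.lid k W).toLinearMap ∘ₗ LinearMap.rTensor W φ) h

theorem inTensorAlgebra_ne_zero {m : ℕ} {s : ⨂[k]^m Z} (hs : s ≠ 0) : inTensorAlgebra s ≠ 0 :=
  fun h => hs (toTensorAlgebra_injective _ (h.trans (map_zero _).symm))

variable {N r n : ℕ} {s : ⨂[k]^(N + r) Z}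

/-- The coaction on a superpotential in terms of the top cohomology class. -/
theorem exists_tensorRightCoaction_eq [FiniteDimensional k Z] (hN : 2 ≤ N)
    (hs : IsTwistedSuperpotential s) (hKoszul : IsNKoszul N r s)
    (hreg : IsLeftASRegular (augmentation N r hN s) (n + 1))
    (hm : N + r = koszulDegree N (n + 1))
    {ρ : SuperpotentialAlgebra N r s →ₐ[k] SuperpotentialAlgebra N r s ⊗[k] H}
    (hgr : IsRightSubcomodule ρ.toLinearMap (gradedPiece N r s 1))
    (hco : ∀ a, slice _ (Coalgebra.counit (R := k) (A := H)) (ρ a) = a) {Δ : H →ₐ[k] H ⊗[k] H}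
    (hΔ : ∀ a, TensorProduct.assoc k _ H H (LinearMap.rTensor H ρ.toLinearMap (ρ a)) =
      LinearMap.lTensor _ Δ.toLinearMap (ρ a))
    {Q : ProjResolution (augmentation N r hN s)} (cQ : CompatibleCoaction ρ Q)
    {e : Q.P (n + 1) →ₗ[k] k} (he : Q.IsCocycle e) (he' : ¬ Q.IsCoboundary e) :
    s ≠ 0 ∧ ∃ h : H, tensorRightCoaction N r hN s ρ (inTensorAlgebra s) = inTensorAlgebra s ⊗ₜ h ∧
      Coalgebra.counit (R := k) h = 1 ∧ Δ h = h ⊗ₜ h ∧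
      ∃ y : Q.P (n + 1), e y ≠ 0 ∧
        TensorProduct.lid k H (LinearMap.rTensor H e (cQ.coact (n + 1) y)) = e y • h ∧
        ∀ (V : Type u) [AddCommGroup V] [Module k V] (b : Q.P (n + 1) →ₗ[k] V),
          Q.IsCoboundary b → b y = 0 := by
  have hdeg := degreeOne_quotientMap_ι N r hN s
  have hqs := quotientMap_surjective N r s
  have hε := augmentation_quotientMap hN s
  have hR : ∀ t ∈ tensorPiece k Z N, t ∈ relationSpace N r s ↔ quotientMap N r s t = 0 :=
    fun t ht => ⟨quotientMap_relation, mem_relationSpace_of_quotientMap_eq_zero ht⟩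
  obtain ⟨hs₀, h, hh, hy⟩ := exists_coact_eq_tmul hN hs hm hqs hε hKoszul.exact_koszulMap hreg
    (rTensor_liftCoaction hgr hdeg) (lid_rTensor_coact hgr hqs hε)
    isRightSubcomodule_tensorPiece (isRightSubcomodule_koszulIncl hgr hdeg hR) cQ he he'
  have hs₁ := inTensorAlgebra_ne_zero hs₀
  refine ⟨hs₀, h, hh, ?_, ?_, hy⟩
  -- Since `s ≠ 0`, it can be cancelled from the counit identity, and below from coassociativity,
  -- leaving the two group-like conditions on `h`.
  · have := slice_counit_liftCoaction hdeg hco (inTensorAlgebra s)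
    rw [hh, slice_tmul] at this
    exact smul_left_injective k hs₁ (this.trans (one_smul k _).symm)
  · have := liftCoaction_coassoc hgr hdeg hΔ (inTensorAlgebra s)
    rw [hh, LinearMap.rTensor_tmul, AlgHom.toLinearMap_apply, hh, TensorProduct.assoc_tmul,
      LinearMap.lTensor_tmul] at this
    exact (tmul_left_injective hs₁ this).symm

end Main

/-! ### Left coactions as right coactions of the co-opposite bialgebra. -/

section LeftToRight

variable {k : Type u} [Field k] {H : Type u} [Ring H] [HopfAlgebra k H]
  {A : Type u} [Ring A] [Algebra k A]

/-- The right coaction of the co-opposite Hopf algebra that belongs to a left coaction. -/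
noncomputable def flipCoaction (ρ : A →ₐ[k] H ⊗[k] A) : A →ₐ[k] A ⊗[k] H :=
  (Algebra.TensorProduct.comm k H A).toAlgHom.comp ρ

theorem flipCoaction_apply (ρ : A →ₐ[k] H ⊗[k] A) (a : A) :
    flipCoaction ρ a = TensorProduct.comm k H A (ρ a) :=
  rfl

theorem IsLeftSubcomodule.flip {ρ : A →ₐ[k] H ⊗[k] A} {W : Submodule k A}
    (h : IsLeftSubcomodule ρ.toLinearMap W) :
    IsRightSubcomodule (flipCoaction ρ).toLinearMap W :=
  fun w hw => (mem_range_lTensor_iff W _).mp (h w hw)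

variable (k H) in
/-- The co-opposite comultiplication. -/
noncomputable def coopComul : H →ₐ[k] H ⊗[k] H :=
  (Algebra.TensorProduct.comm k H H).toAlgHom.comp (Bialgebra.comulAlgHom k H)

theorem coopComul_apply (h : H) :
    coopComul k H h = TensorProduct.comm k H H (Coalgebra.comul h) :=
  rfl

theorem IsLeftCoaction.slice_counit_flip {ρ : A →ₐ[k] H ⊗[k] A}
    (hρ : IsLeftCoaction ρ.toLinearMap) (a : A) :
    slice A (Coalgebra.counit (R := k) (A := H)) (flipCoaction ρ a) = a := by
  have h : ∀ x : H ⊗[k] A, slice A (Coalgebra.counit (R := k) (A := H))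
      (TensorProduct.comm k H A x) =
      TensorProduct.lid k A (LinearMap.rTensor A (Coalgebra.counit (R := k) (A := H)) x) := by
    intro x
    induction x with
    | zero => simp
    | add x y hx hy => simp only [map_add, hx, hy]
    | tmul h a => simp [slice_tmul]
  rw [flipCoaction_apply, h]
  exact LinearMap.congr_fun hρ.counit a

theorem IsLeftCoaction.flip_coassoc {ρ : A →ₐ[k] H ⊗[k] A}
    (hρ : IsLeftCoaction ρ.toLinearMap) (a : A) :
    TensorProduct.assoc k A H H (LinearMap.rTensor H (flipCoaction ρ).toLinearMap
      (flipCoaction ρ a)) = LinearMap.lTensor A (coopComul k H).toLinearMap (flipCoaction ρ a) := by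
  let P : H ⊗[k] (H ⊗[k] A) →ₗ[k] A ⊗[k] (H ⊗[k] H) :=
    (TensorProduct.assoc k A H H).toLinearMap ∘ₗ
      LinearMap.rTensor H (TensorProduct.comm k H A).toLinearMap ∘ₗ
        (TensorProduct.comm k H (H ⊗[k] A)).toLinearMap
  have h₁ : ∀ x : H ⊗[k] A, TensorProduct.assoc k A H H (LinearMap.rTensor H
      (flipCoaction ρ).toLinearMap (TensorProduct.comm k H A x)) =
      P (LinearMap.lTensor H ρ.toLinearMap x) := by
    intro x
    induction x with
    | zero => simp
    | add x y hx hy => simp only [map_add, hx, hy]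
    | tmul h a => simp [P, flipCoaction_apply]
  have h₂ : ∀ x : H ⊗[k] A, LinearMap.lTensor A (coopComul k H).toLinearMap
      (TensorProduct.comm k H A x) = P (TensorProduct.assoc k H H A
        (LinearMap.rTensor A (Coalgebra.comul (R := k) (A := H)) x)) := by
    intro x
    induction x with
    | zero => simp
    | add x y hx hy => simp only [map_add, hx, hy]
    | tmul h a =>
      simp only [TensorProduct.comm_tmul, LinearMap.lTensor_tmul, LinearMap.rTensor_tmul,
        AlgHom.toLinearMap_apply, coopComul_apply]
      generalize (Coalgebra.comul (R := k) h) = z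
      induction z with
      | zero => simp
      | add x y hx hy => simp only [map_add, TensorProduct.add_tmul, TensorProduct.tmul_add, hx, hy]
      | tmul h h' => simp [P]
  rw [flipCoaction_apply, h₁, h₂]
  exact congrArg P (LinearMap.congr_fun hρ.coassoc a).symm

theorem comm_map₂ {M : Type u} [AddCommGroup M] [Module k M] [Module A M] [IsScalarTower k A M]
    (α : H ⊗[k] A) (x : H ⊗[k] M) :
    TensorProduct.comm k H M (TensorProduct.map₂ (LinearMap.mul k H)
      (Algebra.lsmul k k M).toLinearMap α x) =
      tensorAct A H M (TensorProduct.comm k H A α) (TensorProduct.comm k H M x) := by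
  induction α with
  | zero => simp
  | add α α' h h' => simp only [map_add, LinearMap.add_apply, h, h']
  | tmul h a =>
    induction x with
    | zero => simp
    | add x y hx hy => simp only [map_add, hx, hy]
    | tmul m h'' => simp [tensorAct]

variable {ε : A →ₐ[k] k}

/-- The coactions of a resolution by right Hopf modules. -/
def RightHopfResolution.compatibleCoaction {ρ : A →ₐ[k] A ⊗[k] H}
    (Q : RightHopfResolution ρ ε) : CompatibleCoaction ρ Q.toProjResolution where
  coact := Q.coact
  coact_smul := Q.coact_smul
  coact_diff := Q.coact_diff
  coact_aug := Q.coact_aug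

/-- The coactions of a resolution by left Hopf modules, written on the right. -/
noncomputable def LeftHopfResolution.compatibleCoaction {ρ : A →ₐ[k] H ⊗[k] A}
    (Q : LeftHopfResolution ρ ε) : CompatibleCoaction (flipCoaction ρ) Q.toProjResolution where
  coact i := (TensorProduct.comm k H (Q.P i)).toLinearMap ∘ₗ Q.coact i
  coact_smul i a p := by
    rw [LinearMap.comp_apply, Q.coact_smul]
    exact comm_map₂ _ _
  coact_diff i p := by
    simp only [LinearMap.comp_apply, LinearEquiv.coe_coe]
    rw [Q.coact_diff, LinearMap.rTensor_comm]
  coact_aug p := by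
    simp only [LinearMap.comp_apply, LinearEquiv.coe_coe]
    rw [LinearMap.rTensor_comm, Q.coact_aug, TensorProduct.comm_tmul]

theorem RightHopfResolution.dualCoact_apply {ρ : A →ₐ[k] A ⊗[k] H}
    (Q : RightHopfResolution ρ ε) {i : ℕ} (f : Q.P i →ₗ[k] k) (p : Q.P i) :
    Q.dualCoact f p = HopfAlgebra.antipode k
      (TensorProduct.lid k H (LinearMap.rTensor H f (Q.compatibleCoaction.coact i p))) :=
  rfl

theorem LeftHopfResolution.dualCoact_apply {ρ : A →ₐ[k] H ⊗[k] A}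
    (Q : LeftHopfResolution ρ ε) {i : ℕ} (f : Q.P i →ₗ[k] k) (p : Q.P i) :
    Q.dualCoact f p = HopfAlgebra.antipode k
      (TensorProduct.lid k H (LinearMap.rTensor H f (Q.compatibleCoaction.coact i p))) := by
  have h : ∀ x : H ⊗[k] Q.P i, TensorProduct.rid k H (LinearMap.lTensor H f x) =
      TensorProduct.lid k H (LinearMap.rTensor H f (TensorProduct.comm k H (Q.P i) x)) := by
    intro x
    induction x with
    | zero => simp
    | add x y hx hy => simp only [map_add, hx, hy]
    | tmul h a => simp
  exact congrArg _ (h _)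

variable {Z : Type u} [AddCommGroup Z] [Module k Z]

theorem comm_lift_eq_liftCoaction (q : TensorAlgebra k Z →ₐ[k] A) (deg : A →ₗ[k] Z)
    (ρ : A →ₐ[k] H ⊗[k] A) (t : TensorAlgebra k Z) :
    TensorProduct.comm k H (TensorAlgebra k Z)
      (TensorAlgebra.lift k (LinearMap.lTensor H (TensorAlgebra.ι k ∘ₗ deg) ∘ₗ ρ.toLinearMap ∘ₗ
        q.toLinearMap ∘ₗ TensorAlgebra.ι k) t) = liftCoaction q deg (flipCoaction ρ) t := by
  have h : (Algebra.TensorProduct.comm k H (TensorAlgebra k Z)).toAlgHom.comp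
      (TensorAlgebra.lift k (LinearMap.lTensor H (TensorAlgebra.ι k ∘ₗ deg) ∘ₗ ρ.toLinearMap ∘ₗ
        q.toLinearMap ∘ₗ TensorAlgebra.ι k)) = liftCoaction q deg (flipCoaction ρ) := by
    ext z
    change TensorProduct.comm k H (TensorAlgebra k Z) (TensorAlgebra.lift k _
      (TensorAlgebra.ι k z)) = liftCoaction q deg (flipCoaction ρ) (TensorAlgebra.ι k z)
    rw [TensorAlgebra.lift_ι_apply, liftCoaction_ι, flipCoaction_apply, LinearMap.rTensor_comm]
    rfl
  exact AlgHom.congr_fun h t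

end LeftToRight

/-! ### Identification of `h` with the codeterminant or its inverse. -/

section Codeterminant

variable {k Z : Type u} [Field k] [AddCommGroup Z] [Module k Z] [FiniteDimensional k Z]
  {H : Type u} [Ring H] [HopfAlgebra k H] {N r d : ℕ} {s : ⨂[k]^(N + r) Z}

/-- Evaluation at `y`, where coboundaries vanish, turns equality up to coboundary into `e y • (S h -
g) = 0`. -/
theorem eq_antipode_of_isCoboundary {A : Type u} [Ring A] [Algebra k A] {ε : A →ₐ[k] k}
    {Q : ProjResolution ε} {i : ℕ} {e : Q.P i →ₗ[k] k} {f : Q.P i →ₗ[k] H} {g h : H}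
    {y : Q.P i} (hf : Q.IsCoboundary (f - e.smulRight g))
    (hy : ∀ b : Q.P i →ₗ[k] H, Q.IsCoboundary b → b y = 0)
    (hfy : f y = HopfAlgebra.antipode k (e y • h)) (hey : e y ≠ 0) :
    HopfAlgebra.antipode k h = g := by
  have h₁ := hy _ hf
  rw [LinearMap.sub_apply, LinearMap.smulRight_apply, hfy, map_smul, ← smul_sub] at h₁
  exact sub_eq_zero.mp ((smul_eq_zero.mp h₁).resolve_left hey)

theorem exists_eq_add_one_of_koszulDegree (hN : 2 ≤ N) (hm : N + r = koszulDegree N d) :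
    ∃ n, d = n + 1 := by
  cases d with
  | zero => rw [koszulDegree] at hm; omega
  | succ n => exact ⟨n, rfl⟩

/-- The coaction on a superpotential in terms of the homological codeterminant of a right
coaction. -/
theorem tensorRightCoaction_eq_of_isRightCodeterminant (hN : 2 ≤ N)
    (hs : IsTwistedSuperpotential s) (hKoszul : IsNKoszul N r s)
    (hreg : IsLeftASRegular (augmentation N r hN s) d) (hm : N + r = koszulDegree N d)
    {ρ : SuperpotentialAlgebra N r s →ₐ[k] SuperpotentialAlgebra N r s ⊗[k] H} {D : H}
    (hρ : IsGradedRightCoaction (gradedPiece N r s) ρ)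
    (hD : IsRightCodeterminant ρ (augmentation N r hN s) d D) :
    s ≠ 0 ∧ ∃ U : Hˣ, (U : H) = D ∧ tensorRightCoaction N r hN s ρ (inTensorAlgebra s) =
      inTensorAlgebra s ⊗ₜ[k] ((U⁻¹ : Hˣ) : H) := by
  obtain ⟨n, rfl⟩ := exists_eq_add_one_of_koszulDegree hN hm
  obtain ⟨Q, e, he, he', hcob⟩ := hD
  obtain ⟨hs0, h, hsh, hcounit, hcomul, y, hey, hy, hyb⟩ :=
    exists_tensorRightCoaction_eq hN hs hKoszul hreg hm (hρ.graded 1)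
      (LinearMap.congr_fun hρ.coaction.counit) (Δ := Bialgebra.comulAlgHom k H)
      (LinearMap.congr_fun hρ.coaction.coassoc) Q.compatibleCoaction he he'
  have hh : IsGroupLikeElem k h := ⟨hcounit, hcomul⟩
  have hSh := eq_antipode_of_isCoboundary hcob (fun b hb => hyb H b hb)
    ((Q.dualCoact_apply e y).trans (congrArg _ hy)) hey
  -- The unit is `S(h) = D` with inverse `h`, so `D` is shown to be invertible here and not assumed
  -- to be.
  exact ⟨hs0, ⟨HopfAlgebra.antipode k h, h, hh.antipode_mul_cancel, hh.mul_antipode_cancel⟩,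
    hSh, hsh⟩

/-- The coaction on a superpotential in terms of the homological codeterminant of a left
coaction. -/
theorem tensorLeftCoaction_eq_of_isLeftCodeterminant (hN : 2 ≤ N)
    (hs : IsTwistedSuperpotential s) (hKoszul : IsNKoszul N r s)
    (hreg : IsLeftASRegular (augmentation N r hN s) d) (hm : N + r = koszulDegree N d)
    {ρ : SuperpotentialAlgebra N r s →ₐ[k] H ⊗[k] SuperpotentialAlgebra N r s} {D : H}
    (hρ : IsGradedLeftCoaction (gradedPiece N r s) ρ)
    (hD : IsLeftCodeterminant ρ (augmentation N r hN s) d D) :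
    s ≠ 0 ∧ tensorLeftCoaction N r hN s ρ (inTensorAlgebra s) = D ⊗ₜ[k] inTensorAlgebra s := by
  obtain ⟨n, rfl⟩ := exists_eq_add_one_of_koszulDegree hN hm
  obtain ⟨Q, e, he, he', U, rfl, hcob⟩ := hD
  obtain ⟨hs0, h, hsh, hcounit, hcomul, y, hey, hy, hyb⟩ :=
    exists_tensorRightCoaction_eq hN hs hKoszul hreg hm (hρ.graded 1).flip
      hρ.coaction.slice_counit_flip hρ.coaction.flip_coassoc Q.compatibleCoaction he he'
  have hh : IsGroupLikeElem k h := by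
    -- `h` is group-like for the co-opposite comultiplication; `h ⊗ h` is symmetric, so it is so for
    -- the original one.
    refine ⟨hcounit, (TensorProduct.comm k H H).injective ?_⟩
    rw [TensorProduct.comm_tmul]
    exact hcomul
  have hSh := eq_antipode_of_isCoboundary hcob (fun b hb => hyb H b hb)
    ((Q.dualCoact_apply e y).trans (congrArg _ hy)) hey
  -- Here `S(h) = D⁻¹`, and `h * S(h) = 1` gives `h = D`.
  have hU : h = U := by
    rw [← Units.mul_inv_eq_one, ← hSh, hh.mul_antipode_cancel]
  refine ⟨hs0, (TensorProduct.comm k H (TensorAlgebra k Z)).injective ?_⟩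
  rw [TensorProduct.comm_tmul, ← hU]
  exact (comm_lift_eq_liftCoaction _ _ _ _).trans hsh

end Codeterminant

end SuperpotentialHopf

/-! ### The theorem for right and for left coactions. -/

open SuperpotentialHopf in
theorem mainTheorem5 {k Z H : Type u} [Field k] [AddCommGroup Z] [Module k Z]
    [FiniteDimensional k Z] [Ring H] [HopfAlgebra k H]
    (hS : Function.Bijective (HopfAlgebra.antipode k : H →ₗ[k] H))
    (N r d : ℕ) (hN : 2 ≤ N) (s : ⨂[k]^(N + r) Z)
    (hs : IsTwistedSuperpotential s)
    (hKoszul : IsNKoszul N r s)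
    (hRegular : IsASRegular (gradedPiece N r s) (augmentation N r hN s) d)
    (hm : N + r = koszulDegree N d) :
    (∀ (ρ : SuperpotentialAlgebra N r s →ₐ[k] SuperpotentialAlgebra N r s ⊗[k] H) (D : H),
      IsGradedRightCoaction (gradedPiece N r s) ρ →
      IsRightCodeterminant ρ (augmentation N r hN s) d D →
        Module.finrank k (Submodule.span k {inTensorAlgebra s}) = 1 ∧
        IsRightSubcomodule (tensorRightCoaction N r hN s ρ).toLinearMap
          (Submodule.span k {inTensorAlgebra s}) ∧
        (∃ U : Hˣ, (U : H) = D ∧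
          tensorRightCoaction N r hN s ρ (inTensorAlgebra s) =
            inTensorAlgebra s ⊗ₜ[k] ((U⁻¹ : Hˣ) : H)) ∧
        (D = 1 ↔ ∀ w ∈ Submodule.span k {inTensorAlgebra s},
          tensorRightCoaction N r hN s ρ w = w ⊗ₜ[k] (1 : H))) ∧
    (∀ (ρ : SuperpotentialAlgebra N r s →ₐ[k] H ⊗[k] SuperpotentialAlgebra N r s) (D : H),
      IsGradedLeftCoaction (gradedPiece N r s) ρ →
      IsLeftCodeterminant ρ (augmentation N r hN s) d D →
        Module.finrank k (Submodule.span k {inTensorAlgebra s}) = 1 ∧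
        IsLeftSubcomodule (tensorLeftCoaction N r hN s ρ).toLinearMap
          (Submodule.span k {inTensorAlgebra s}) ∧
        tensorLeftCoaction N r hN s ρ (inTensorAlgebra s) = D ⊗ₜ[k] inTensorAlgebra s ∧
        (D = 1 ↔ ∀ w ∈ Submodule.span k {inTensorAlgebra s},
          tensorLeftCoaction N r hN s ρ w = (1 : H) ⊗ₜ[k] w)) := by
  refine ⟨fun ρ D hρ hD => ?_, fun ρ D hρ hD => ?_⟩
  · obtain ⟨hs0, U, rfl, hU⟩ := tensorRightCoaction_eq_of_isRightCodeterminant hN hs hKoszul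
      hRegular.left hm hρ hD
    have hs1 := inTensorAlgebra_ne_zero hs0
    refine ⟨finrank_span_singleton hs1, fun w hw => ?_, ⟨U, rfl, hU⟩, fun h w hw => ?_, fun h => ?_⟩
    · obtain ⟨c, rfl⟩ := Submodule.mem_span_singleton.mp hw
      rw [map_smul, AlgHom.toLinearMap_apply, hU]
      exact Submodule.smul_mem _ _
        (tmul_mem_range_rTensor (Submodule.mem_span_singleton_self _) _)
    · obtain ⟨c, rfl⟩ := Submodule.mem_span_singleton.mp hw
      rw [Units.val_eq_one] at h
      rw [map_smul, hU, h, inv_one, Units.val_one, TensorProduct.smul_tmul']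
    · have h₁ := tmul_left_injective hs1
        (hU.symm.trans (h _ (Submodule.mem_span_singleton_self _)))
      rw [Units.val_eq_one, inv_eq_one] at h₁
      rw [h₁, Units.val_one]
  · obtain ⟨hs0, hD⟩ := tensorLeftCoaction_eq_of_isLeftCodeterminant hN hs hKoszul
      hRegular.left hm hρ hD
    have hs1 := inTensorAlgebra_ne_zero hs0
    refine ⟨finrank_span_singleton hs1, fun w hw => ?_, hD, fun h w hw => ?_, fun h => ?_⟩
    · obtain ⟨c, rfl⟩ := Submodule.mem_span_singleton.mp hw
      rw [map_smul, AlgHom.toLinearMap_apply, hD]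
      refine Submodule.smul_mem _ _ ((mem_range_lTensor_iff _ _).mpr ?_)
      rw [TensorProduct.comm_tmul]
      exact tmul_mem_range_rTensor (Submodule.mem_span_singleton_self _) _
    · obtain ⟨c, rfl⟩ := Submodule.mem_span_singleton.mp hw
      rw [map_smul, hD, h, TensorProduct.tmul_smul]
    · refine tmul_left_injective hs1 ((TensorProduct.comm k _ _).symm.injective ?_)
      simpa using hD.symm.trans (h _ (Submodule.mem_span_singleton_self _))
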